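/- \textbf{Setting.} Let $X=(X_t)_{t\ge 0}$ be a Hunt process with infinite lifetime and state space $S\subseteq\mathbb R$: under $\mathbb P_x$, $x\in S$, it starts at $x$; its paths are right continuous with left limits in $S$; and it is strong Markov and quasi-left-continuous with respect to a right-continuous filtration $\mathcal F=(\mathcal F_t)_{t\ge0}$ to which it is adapted (for example its right-continuous natural filtration, or the augmentation of that filtration). Let $\mathcal M$ be the set of all $\mathcal F$-stopping times with values in $[0,\infty]$. Let $\beta>0$, let $T$ be an exponentially distributed random variable with mean $1/\beta$ that is independent of $X$, and let $M_t:=\sup_{0\le s\le t}X_s$, which is a point of $S$. Let $G:S\to[0,\infty)$ be lower semicontinuous with $\mathbb E_x\big(\sup_{t\ge0}e^{-\beta t}G(X_t)\big)<\infty$ for all $x\in S$. The value function of the optimal stopping problem is $$V(x):=\sup_{\tau\in\mathcal M}\mathbb E_x\big(e^{-\beta\tau}G(X_\tau)\big),\qquad x\in S,$$ where $e^{-\beta\tau}G(X_\tau):=\limsup_{t\to\infty}e^{-\beta t}G(X_t)$ on $\{\tau=\infty\}$. A stopping time $\tau\in\mathcal M$ is called optimal if $V(x)=\mathbb E_x(e^{-\beta\tau}G(X_\tau))$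 for all $x\in S$. \textbf{Theorem (one-sided case).} Assume that there exist an upper semicontinuous function $\hat f:S\to\mathbb R$ and a point $x^*\in S$ such that, with $x$ ranging over $S$, \begin{enumerate} \item[(a)] (i) $\hat f(x)\le 0$ for $x\le x^*$; (ii) $\hat f$ is positive and non-decreasing on $\{x>x^*\}$; \item[(b)] (i) $\mathbb E_x\big(\sup_{0\le t\le T}\hat f(X_t)\big)=G(x)$ for $x\ge x^*$; (ii) $\mathbb E_x\big(\sup_{0\le t\le T}\hat f(X_t)\big)\ge G(x)$ for $x\le x^*$. \end{enumerate} Then for all $x\in S$ $$V(x)=\mathbb E_x\Big(\sup_{0\le t\le T}\hat f(X_t)1_{\{X_t>x^*\}}\Big)=\mathbb E_x\Big(\hat f(M_T)1_{\{M_T>x^*\}}\Big),$$ and $\tau^*:=\inf\{t\ge0:X_t>x^*\}$ (with $\inf\emptyset=\infty$) is an optimal stopping time. If moreover $\hat f(x^*)\ge0$ (which holds automatically when $x^*$ is a limit of points of $S$ from the right), then also, for all $x\in S$, $$V(x)=\mathbb E_x\Big(\sup_{0\le t\le T}\hat f(X_t)1_{\{X_t\ge x^*\}}\Big)=\mathbb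 E_x\Big(\hat f(M_T)1_{\{M_T\ge x^*\}}\Big).$$ -/

import Mathlib

open MeasureTheory ProbabilityTheory Filter Topology Set
open scoped NNReal ENNReal

/-- A Hunt process `(X_t, 𝓕_t, P_x)` with infinite lifetime and state space `S ⊆ ℝ`.  `𝓕` is any
right-continuous filtration to which `X` is adapted and with respect to which `X` is strong Markov
and quasi-left-continuous, for instance the right-continuous natural filtration or its usual
augmentation. -/
structure HuntProcess (S : Set ℝ) (Ω : Type*) [m : MeasurableSpace Ω] where
  /-- the process -/
  X : ℝ≥0 → Ω → S
  /-- the filtration -/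
  𝓕 : Filtration ℝ≥0 m
  /-- the law under which the process starts from `x` -/
  P : S → Measure Ω
  isProbabilityMeasure : ∀ x, IsProbabilityMeasure (P x)
  rightCont_filtration : 𝓕.IsRightContinuous
  adapted : ∀ t, Measurable[𝓕 t] (X t)
  measurable_transition : ∀ (t : ℝ≥0) (B : Set S), MeasurableSet B →
    Measurable fun x => P x {ω | X t ω ∈ B}
  start : ∀ x, ∀ᵐ ω ∂P x, X 0 ω = x
  /-- right-continuous paths -/
  right_cts : ∀ ω t, Tendsto (fun s => X s ω) (𝓝[>] t) (𝓝 (X t ω))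
  /-- left limits in the state space -/
  left_lim : ∀ ω t, ∃ l : S, Tendsto (fun s => X s ω) (𝓝[<] t) (𝓝 l)
  /-- `P_x(A, τ < ∞, X_{τ+t} ∈ B) = E_x(P_{X_τ}(X_t ∈ B); A, τ < ∞)` for every `A ∈ 𝓕_τ` -/
  strong_markov : ∀ (τ : Ω → WithTop ℝ≥0) (hτ : IsStoppingTime 𝓕 τ) (A : Set Ω),
    MeasurableSet[hτ.measurableSpace] A → ∀ (t : ℝ≥0) (B : Set S), MeasurableSet B → ∀ x,
      P x (A ∩ {ω | τ ω ≠ ⊤} ∩ {ω | X ((τ ω).untopA + t) ω ∈ B}) =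
        ∫⁻ ω in A ∩ {ω | τ ω ≠ ⊤}, P (stoppedValue X τ ω) {ω' | X t ω' ∈ B} ∂P x
  /-- `X_{τ_n} → X_τ` a.s. on `{τ < ∞}` for stopping times `τ_n ↑ τ` -/
  quasi_left_cts : ∀ (σ : ℕ → Ω → WithTop ℝ≥0) (τ : Ω → WithTop ℝ≥0),
    (∀ n, IsStoppingTime 𝓕 (σ n)) → IsStoppingTime 𝓕 τ →
    (∀ ω, Monotone fun n => σ n ω) → (∀ ω, IsLUB (range fun n => σ n ω) (τ ω)) →
    ∀ x, ∀ᵐ ω ∂P x, τ ω ≠ ⊤ →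
      Tendsto (fun n => stoppedValue X (σ n) ω) atTop (𝓝 (stoppedValue X τ ω))

namespace HuntProcess

variable {S : Set ℝ} {Ω : Type*} [MeasurableSpace Ω]

/-- Near each time the path is bounded above by a number below `c`, if its value and its left limit
there are below `c`. -/
theorem exists_local_bound (H : HuntProcess S Ω) (ω : Ω) (s : ℝ≥0) (c : ℝ)
    (hs : (H.X s ω : ℝ) < c)
    (hl : ∀ l : S, 0 < s → Tendsto (fun r => H.X r ω) (𝓝[<] s) (𝓝 l) → (l : ℝ) < c) :
    ∃ d < c, ∀ᶠ r in 𝓝 s, (H.X r ω : ℝ) ≤ d := by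
  have hr : Tendsto (fun r => (H.X r ω : ℝ)) (𝓝[>] s) (𝓝 (H.X s ω : ℝ)) :=
    (continuous_subtype_val.tendsto _).comp (H.right_cts ω s)
  obtain ⟨d₁, hd₁, hd₁'⟩ := exists_between hs
  have h1 : ∀ᶠ r in 𝓝[>] s, (H.X r ω : ℝ) ≤ d₁ := hr.eventually (eventually_le_nhds hd₁)
  rcases eq_or_lt_of_le (zero_le : 0 ≤ s) with h0 | h0
  · refine ⟨d₁, hd₁', ?_⟩
    have h2 : ∀ᶠ r in 𝓝[≥] s, (H.X r ω : ℝ) ≤ d₁ := by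
      rw [← Ioi_insert, nhdsWithin_insert]
      exact ⟨hd₁.le, h1⟩
    have : Ici s = univ := by
      ext r; simp [← h0]
    rwa [this, nhdsWithin_univ] at h2
  · obtain ⟨l, hl'⟩ := H.left_lim ω s
    obtain ⟨d₂, hd₂, hd₂'⟩ := exists_between (hl l h0 hl')
    have h2 : ∀ᶠ r in 𝓝[<] s, (H.X r ω : ℝ) ≤ d₂ :=
      ((continuous_subtype_val.tendsto _).comp hl').eventually (eventually_le_nhds hd₂)
    refine ⟨max d₁ d₂, max_lt hd₁' hd₂', ?_⟩
    rw [← nhdsLT_sup_nhdsGE, ← Ioi_insert, nhdsWithin_insert]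
    refine eventually_sup.2 ⟨h2.mono fun r h => h.trans (le_max_right _ _),
      eventually_sup.2 ⟨?_, h1.mono fun r h => h.trans (le_max_left _ _)⟩⟩
    exact hd₁.le.trans (le_max_left _ _)

/-- A path that is bounded above near each time of `[0,t]` is bounded above on `[0,t]`. -/
theorem exists_bound (H : HuntProcess S Ω) (ω : Ω) (t : ℝ≥0)
    (h : ∀ s ≤ t, ∃ d : ℝ, ∀ᶠ r in 𝓝 s, (H.X r ω : ℝ) ≤ d) :
    BddAbove ((fun s => (H.X s ω : ℝ)) '' Iic t) := by
  have hc : IsCompact (Iic t) := by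
    rw [← Icc_bot]; exact isCompact_Icc
  refine hc.induction_on (p := fun U => BddAbove ((fun s => (H.X s ω : ℝ)) '' U)) (by simp)
    (fun U V hUV hV => hV.mono (image_mono hUV)) (fun U V hU hV => by
      rw [image_union]; exact hU.union hV) ?_
  intro s hs
  obtain ⟨d, hd⟩ := h s hs
  exact ⟨_, mem_nhdsWithin_of_mem_nhds hd, d, by rintro _ ⟨r, hr, rfl⟩; exact hr⟩

theorem bddAbove_path (H : HuntProcess S Ω) (ω : Ω) (t : ℝ≥0) :
    BddAbove ((fun s => (H.X s ω : ℝ)) '' Iic t) := by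
  refine H.exists_bound ω t fun s _ => ?_
  obtain ⟨l, hl⟩ := H.left_lim ω s
  obtain ⟨d, -, hd⟩ := H.exists_local_bound ω s (max (H.X s ω : ℝ) l + 1)
    ((le_max_left _ _).trans_lt (lt_add_one _)) (fun l' h0 hl' => by
      have : (𝓝[<] s).NeBot := nhdsLT_neBot_of_exists_lt ⟨0, h0⟩
      rw [tendsto_nhds_unique hl' hl]
      exact (le_max_right _ _).trans_lt (lt_add_one _))
  exact ⟨d, hd⟩

/-- The running supremum belongs to the state space, which contains the left limits. -/
theorem sSup_path_mem (H : HuntProcess S Ω) (ω : Ω) (t : ℝ≥0) :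
    sSup ((fun s => (H.X s ω : ℝ)) '' Iic t) ∈ S := by
  set c := sSup ((fun s => (H.X s ω : ℝ)) '' Iic t) with hcdef
  by_contra hc
  have hle : ∀ s ≤ t, (H.X s ω : ℝ) ≤ c := fun s hs =>
    le_csSup (H.bddAbove_path ω t) ⟨s, hs, rfl⟩
  have hloc : ∀ s ≤ t, ∃ d < c, ∀ᶠ r in 𝓝 s, (H.X r ω : ℝ) ≤ d := by
    intro s hs
    refine H.exists_local_bound ω s c
      (lt_of_le_of_ne (hle s hs) fun h => hc (h ▸ (H.X s ω).2)) fun l h0 hl => ?_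
    have : (𝓝[<] s).NeBot := nhdsLT_neBot_of_exists_lt ⟨0, h0⟩
    refine lt_of_le_of_ne ?_ fun h => hc (h ▸ l.2)
    refine le_of_tendsto ((continuous_subtype_val.tendsto _).comp hl) ?_
    filter_upwards [self_mem_nhdsWithin] with r hr
    exact hle r (le_of_lt (lt_of_lt_of_le hr hs))
  have hcomp : IsCompact (Iic t) := by
    rw [← Icc_bot]; exact isCompact_Icc
  obtain ⟨d, hd, hd'⟩ : ∃ d < c, ∀ s ∈ Iic t, (H.X s ω : ℝ) ≤ d := by
    refine hcomp.induction_on (p := fun U => ∃ d < c, ∀ s ∈ U, (H.X s ω : ℝ) ≤ d)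
      ⟨c - 1, by linarith, by simp⟩ ?_ ?_ ?_
    · rintro U V hUV ⟨d, hd, h⟩
      exact ⟨d, hd, fun s hs => h s (hUV hs)⟩
    · rintro U V ⟨d, hd, h⟩ ⟨e, he, h'⟩
      refine ⟨max d e, max_lt hd he, ?_⟩
      rintro s (hs | hs)
      · exact (h s hs).trans (le_max_left _ _)
      · exact (h' s hs).trans (le_max_right _ _)
    · intro s hs
      obtain ⟨d, hd, h⟩ := hloc s hs
      exact ⟨_, mem_nhdsWithin_of_mem_nhds h, d, hd, fun r hr => hr⟩
  have : c ≤ d := csSup_le ⟨_, 0, (zero_le : (0 : ℝ≥0) ≤ t), rfl⟩ (by rintro _ ⟨s, hs, rfl⟩; exact hd' s hs)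
  linarith

/-- The running maximum `M_t = sup_{0 ≤ s ≤ t} X_s`, as a point of the state space. -/
noncomputable def runningMax (H : HuntProcess S Ω) (t : ℝ≥0) (ω : Ω) : S :=
  ⟨sSup ((fun s => (H.X s ω : ℝ)) '' Iic t), H.sSup_path_mem ω t⟩

/-- The expectation `E_x(Y)` of an extended real variable, as `E_x(Y⁺) - E_x(Y⁻)`. -/
noncomputable def expect (H : HuntProcess S Ω) (x : S) (Y : Ω → EReal) : EReal :=
  ((∫⁻ ω, (Y ω).toENNReal ∂H.P x : ℝ≥0∞) : EReal) -
    ((∫⁻ ω, (-Y ω).toENNReal ∂H.P x : ℝ≥0∞) : EReal)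

/-- `sup_{0 ≤ s ≤ t} f(X_s)`. -/
noncomputable def supUpTo (H : HuntProcess S Ω) (f : S → ℝ) (t : ℝ≥0) (ω : Ω) : EReal :=
  ⨆ (s : ℝ≥0) (_ : s ≤ t), (f (H.X s ω) : EReal)

/-- The discounted reward `e^{-βt} G(X_t)`. -/
noncomputable def discounted (H : HuntProcess S Ω) (β : ℝ) (G : S → ℝ) (t : ℝ≥0) (ω : Ω) : ℝ≥0∞ :=
  ENNReal.ofReal (Real.exp (-β * t) * G (H.X t ω))

/-- The payoff `e^{-βτ} G(X_τ)`, read as `limsup_{t → ∞} e^{-βt} G(X_t)` on `{τ = ∞}`. -/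
noncomputable def payoff (H : HuntProcess S Ω) (β : ℝ) (G : S → ℝ) (τ : Ω → WithTop ℝ≥0) (ω : Ω) :
    ℝ≥0∞ :=
  open scoped Classical in
  if τ ω = ⊤ then limsup (fun t : ℝ≥0 => H.discounted β G t ω) atTop
  else H.discounted β G (τ ω).untopA ω

/-- The value function `V(x) = sup_τ E_x(e^{-βτ} G(X_τ))` over all stopping times. -/
noncomputable def value (H : HuntProcess S Ω) (β : ℝ) (G : S → ℝ) (x : S) : ℝ≥0∞ :=
  ⨆ (τ : Ω → WithTop ℝ≥0) (_ : IsStoppingTime H.𝓕 τ), ∫⁻ ω, H.payoff β G τ ω ∂H.P x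

/-- `τ` is an optimal stopping time: it attains the value function from every starting point. -/
def IsOptimal (H : HuntProcess S Ω) (β : ℝ) (G : S → ℝ) (τ : Ω → WithTop ℝ≥0) : Prop :=
  IsStoppingTime H.𝓕 τ ∧ ∀ x, ∫⁻ ω, H.payoff β G τ ω ∂H.P x = H.value β G x

/-- `inf {t ≥ 0 : X_t > y}`, with `inf ∅ = ∞`. -/
noncomputable def passageAbove (H : HuntProcess S Ω) (y : S) : Ω → WithTop ℝ≥0 :=
  hittingAfter H.X (Ioi y) 0

end HuntProcess

/-!
Write `g = f⁺`, which is monotone on `S` and vanishes up to `xs`, and let `R y = E_y g(M_T)` be the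
functional `maxReward`.  The theorem says that `R` is the value function.

* *`R` is the functional of the hypotheses.*  By quasi-left-continuity every fixed level is almost
  surely attained when it is the running maximum (`ae_exists_le_X_of_runningMax_eq`); a monotone
  function has only countably many jumps, so `sup_{t ≤ T} g(X_t) = g(M_T)` almost surely
  (`ae_iSup_eq_runningMax`), whether or not the maximum is attained.  Hence `G ≤ R` everywhere.
  Equality `G = R` holds at the points `y ≥ xs` with `f y ≥ 0`, where `sup_{t ≤ T} f(X_t)` has no
  negative part; by upper semicontinuity these include the closure of `{y > xs}`, where the process
  is at its first passage above `xs`.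

* *Strong Markov property and lack of memory.*  For a stopping time `τ`,
  `E_x(e^{-βτ} R(X_τ); τ < ∞) = E_x ∫_{u > τ} g(sup_{τ ≤ s ≤ u} X_s) μ(du)`, where `μ` is the
  exponential law (`setLIntegral_exp_mul_maxReward`).  The exponential time is integrated out here,
  since it is independent of `X` but not necessarily of the filtration.

* *Upper bound.*  Bounding the supremum over `[τ, u]` by the one over `[0, u]` gives
  `E_x(e^{-βτ} G(X_τ); τ < ∞) ≤ R x`.  For `τ ≥ n` only times `u > n` contribute, which yields a
  maximal inequality and shows that `e^{-βt} G(X_t)` tends to zero almost surely when `R x < ∞`, so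
  that never stopping earns nothing (`ae_limsup_discounted_eq_zero`).

* *Attainment.*  For the passage time above `xs` the supremum over `[τ, u]` is the supremum over
  `[0, u]` when `u > τ`, while `g(M_u) = 0` when `u < τ`, and `u = τ` has probability zero.  So
  nothing is lost (`maxReward_le_lintegral_payoff_passageAbove`).

The Markov property is given at a single time only.  It is extended to whole paths by way of grids
(`measure_grid_eq`): finitely many rational times lie on a common grid, and by right-continuity the
path at rational times determines the running supremum (`pathSup_eq_iSup`).
-/

/-! ### Integrals with weights and the exponential law -/

theorem lintegral_mul_eq_of_forall_setLIntegral_eq {α : Type*} {m' m : MeasurableSpace α}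
    (hm : m' ≤ m) {ν : Measure α} {F F' : α → ℝ≥0∞} (hF : Measurable F) (hF' : Measurable F')
    (h : ∀ A, MeasurableSet[m'] A → ∫⁻ a in A, F a ∂ν = ∫⁻ a in A, F' a ∂ν)
    {w : α → ℝ≥0∞} (hw : Measurable[m'] w) :
    ∫⁻ a, w a * F a ∂ν = ∫⁻ a, w a * F' a ∂ν := by
  refine Measurable.ennreal_induction (mα := m')
    (motive := fun w => ∫⁻ a, w a * F a ∂ν = ∫⁻ a, w a * F' a ∂ν) ?_ ?_ ?_ hw
  · intro c s hs
    have key : ∀ K : α → ℝ≥0∞, Measurable K →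
        ∫⁻ a, s.indicator (fun _ => c) a * K a ∂ν = c * ∫⁻ a in s, K a ∂ν := by
      intro K hK
      rw [← lintegral_const_mul c hK, ← lintegral_indicator (hm s hs)]
      refine lintegral_congr fun a => ?_
      by_cases ha : a ∈ s <;> simp [ha]
    rw [key F hF, key F' hF', h s hs]
  · intro v v' _ hv hv' h1 h2
    simp only [Pi.add_apply, add_mul]
    rw [lintegral_add_left ((hv.mono hm le_rfl).fun_mul hF), h1, h2,
      lintegral_add_left ((hv.mono hm le_rfl).fun_mul hF')]
  · intro v hv hmono h1
    simp only [ENNReal.iSup_mul]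
    rw [lintegral_iSup (fun n => ((hv n).mono hm le_rfl).fun_mul hF)
        (fun i j hij a => mul_le_mul_left (hmono hij a) _),
      lintegral_iSup (fun n => ((hv n).mono hm le_rfl).fun_mul hF')
        (fun i j hij a => mul_le_mul_left (hmono hij a) _)]
    simp only [h1]

theorem lintegral_of_map_coe_eq {μ : Measure ℝ≥0} {ν : Measure ℝ}
    (hμ : μ.map ((↑) : ℝ≥0 → ℝ) = ν) {φ : ℝ≥0 → ℝ≥0∞} (hφ : Measurable φ) :
    ∫⁻ r, φ r ∂μ = ∫⁻ x, φ x.toNNReal ∂ν := by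
  have h : Measurable fun x : ℝ => φ x.toNNReal := hφ.comp measurable_real_toNNReal
  rw [← hμ, lintegral_map h measurable_coe_nnreal_real]
  simp

theorem lintegral_expMeasure (β : ℝ) {φ : ℝ → ℝ≥0∞} (hφ : Measurable φ) :
    ∫⁻ x, φ x ∂expMeasure β = ∫⁻ x, exponentialPDF β x * φ x := by
  have h : expMeasure β = volume.withDensity (exponentialPDF β) := rfl
  have hm : Measurable (exponentialPDF β) := (measurable_exponentialPDFReal β).ennreal_ofReal
  rw [h, lintegral_withDensity_eq_lintegral_mul _ hm hφ]
  rfl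

/-- The lack of memory of the exponential law, in integrated form. -/
theorem exp_mul_lintegral_eq_setLIntegral_Ioi {μ : Measure ℝ≥0} {β : ℝ}
    (hμ : μ.map ((↑) : ℝ≥0 → ℝ) = expMeasure β) (t : ℝ≥0) {φ : ℝ≥0 → ℝ≥0∞} (hφ : Measurable φ) :
    ENNReal.ofReal (Real.exp (-β * t)) * ∫⁻ r, φ r ∂μ = ∫⁻ u in Ioi t, φ (u - t) ∂μ := by
  have hmeas : Measurable ((Ioi t).indicator fun u => φ (u - t)) :=
    (hφ.comp (measurable_id.sub_const t)).indicator measurableSet_Ioi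
  have hφ' : Measurable fun x : ℝ => φ x.toNNReal := hφ.comp measurable_real_toNNReal
  have hmeas' : Measurable fun x : ℝ => (Ioi t).indicator (fun u => φ (u - t)) x.toNNReal :=
    hmeas.comp measurable_real_toNNReal
  have hpdf : Measurable (exponentialPDF β) := (measurable_exponentialPDFReal β).ennreal_ofReal
  rw [← lintegral_indicator measurableSet_Ioi, lintegral_of_map_coe_eq hμ hφ,
    lintegral_of_map_coe_eq hμ hmeas, lintegral_expMeasure β hφ', lintegral_expMeasure β hmeas',
    ← lintegral_add_right_eq_self (fun x => exponentialPDF β x *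
      (Ioi t).indicator (fun u => φ (u - t)) x.toNNReal) (t : ℝ),
    ← lintegral_const_mul _ (hpdf.fun_mul hφ')]
  refine lintegral_congr_ae ?_
  have h0 : ∀ᵐ x : ℝ, x ≠ 0 := by simp [ae_iff]
  filter_upwards [h0] with x hx
  rcases lt_or_gt_of_ne hx with hx | hx
  · have h1 : Real.toNNReal (x + t) ∉ Ioi t := by
      simp only [mem_Ioi, not_lt]
      rw [Real.toNNReal_le_iff_le_coe]; linarith
    simp [exponentialPDF_of_neg hx, h1]
  · have h1 : Real.toNNReal (x + t) ∈ Ioi t := by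
      simp only [mem_Ioi]
      rw [Real.lt_toNNReal_iff_coe_lt]; linarith
    have h2 : Real.toNNReal (x + t) - t = Real.toNNReal x := by
      rw [Real.toNNReal_add hx.le t.coe_nonneg]; simp
    have h3 : (0 : ℝ) ≤ x + t := add_nonneg hx.le t.2
    simp only [indicator_of_mem h1, h2]
    rw [exponentialPDF_of_nonneg hx.le, exponentialPDF_of_nonneg h3, ← mul_assoc,
      ← ENNReal.ofReal_mul (Real.exp_pos _).le]
    congr 2
    rw [mul_left_comm, ← Real.exp_add]
    ring_nf

/-! ### Running suprema of paths sampled at rational times -/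

theorem exists_nnrat_btwn {a b : ℝ≥0} (h : a < b) : ∃ q : ℚ≥0, a < q ∧ (q : ℝ≥0) < b := by
  obtain ⟨q, hq1, hq2⟩ := exists_rat_btwn (show (a : ℝ) < b from h)
  have hq0 : (0 : ℚ) ≤ q := by exact_mod_cast a.2.trans hq1.le
  lift q to ℚ≥0 using hq0
  refine ⟨q, ?_, ?_⟩
  · rw [← NNReal.coe_lt_coe]; exact_mod_cast hq1
  · rw [← NNReal.coe_lt_coe]; exact_mod_cast hq2

section PathSup

variable {S : Set ℝ}

/-- The running supremum at time `r` of a path that is known at rational times only, read as the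
limit from the right of the suprema over rational times. -/
noncomputable def pathSup (p : ℚ≥0 → S) (r : ℝ≥0) : EReal :=
  ⨅ (q : ℚ≥0) (_ : r < q), ⨆ (s : ℚ≥0) (_ : s ≤ q), ((p s : ℝ) : EReal)

theorem measurable_pathSup : Measurable fun z : (ℚ≥0 → S) × ℝ≥0 => pathSup z.1 z.2 := by
  classical
  unfold pathSup
  refine Measurable.iInf fun q => ?_
  have h : ∀ z : (ℚ≥0 → S) × ℝ≥0,
      (⨅ (_ : z.2 < q), ⨆ (s : ℚ≥0) (_ : s ≤ q), ((z.1 s : ℝ) : EReal)) =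
        if z.2 < q then ⨆ (s : ℚ≥0) (_ : s ≤ q), ((z.1 s : ℝ) : EReal) else ⊤ := by
    intro z; split_ifs with h <;> simp [h]
  simp only [h]
  refine Measurable.ite (measurableSet_lt measurable_snd measurable_const) ?_ measurable_const
  refine Measurable.iSup fun s => Measurable.iSup fun _ => ?_
  exact measurable_coe_real_ereal.comp (measurable_subtype_coe.comp
    ((measurable_pi_apply s).comp measurable_fst))

/-- A right-continuous path may be sampled at rational times to compute its running supremum. -/
theorem pathSup_eq_iSup (x : ℝ≥0 → S) (hx : ∀ t, Tendsto x (𝓝[>] t) (𝓝 (x t))) (r : ℝ≥0) :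
    pathSup (fun q => x q) r = ⨆ (s : ℝ≥0) (_ : s ≤ r), ((x s : ℝ) : EReal) := by
  have hx' : ∀ t, Tendsto (fun s => ((x s : ℝ) : EReal)) (𝓝[>] t) (𝓝 ((x t : ℝ) : EReal)) :=
    fun t => ((continuous_coe_real_ereal.comp continuous_subtype_val).tendsto _).comp (hx t)
  apply le_antisymm
  · refine le_of_forall_gt_imp_ge_of_dense fun c hc => ?_
    have hle : ∀ s ≤ r, ((x s : ℝ) : EReal) < c := fun s hs =>
      lt_of_le_of_lt (le_iSup₂ (f := fun (s : ℝ≥0) (_ : s ≤ r) => ((x s : ℝ) : EReal)) s hs) hc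
    have h1 : ∀ᶠ s in 𝓝[>] r, ((x s : ℝ) : EReal) < c :=
      (hx' r).eventually (gt_mem_nhds (hle r le_rfl))
    obtain ⟨u, hu, hu'⟩ := (mem_nhdsGT_iff_exists_Ioo_subset).1 h1
    obtain ⟨q, hq, hq'⟩ := exists_nnrat_btwn hu
    refine (iInf₂_le q hq).trans (iSup₂_le fun s hs => ?_)
    rcases le_or_gt (s : ℝ≥0) r with h | h
    · exact (hle _ h).le
    · exact le_of_lt (hu' ⟨h, lt_of_le_of_lt (by exact_mod_cast hs) hq'⟩)
  · refine iSup₂_le fun s hs => le_iInf₂ fun q hq => ?_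
    by_contra! hlt
    obtain ⟨u, hu, hu'⟩ := (mem_nhdsGT_iff_exists_Ioo_subset).1
      ((hx' s).eventually (lt_mem_nhds hlt))
    obtain ⟨s', hs', hs''⟩ := exists_nnrat_btwn (lt_min hu (lt_of_le_of_lt hs hq))
    have h1 := hu' (show (s' : ℝ≥0) ∈ Ioo s u from ⟨hs', hs''.trans_le (min_le_left _ _)⟩)
    have h2 : s' ≤ q := by exact_mod_cast (hs''.trans_le (min_le_right _ _)).le
    exact absurd (le_iSup₂ (f := fun (s : ℚ≥0) (_ : s ≤ q) => ((x s : ℝ) : EReal)) s' h2)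
      (not_le.2 h1)

/-- The supremum of `g` up to `z`.  For monotone `g` this is a monotone extension of `g` to the
extended reals. -/
noncomputable def leftSup (g : S → ℝ≥0∞) (z : EReal) : ℝ≥0∞ :=
  ⨆ (y : S) (_ : ((y : ℝ) : EReal) ≤ z), g y

theorem monotone_leftSup (g : S → ℝ≥0∞) : Monotone (leftSup g) := fun _ _ h =>
  iSup₂_le fun y hy => le_iSup₂ (f := fun (y : S) (_ : ((y : ℝ) : EReal) ≤ _) => g y) y (hy.trans h)

theorem leftSup_coe {g : S → ℝ≥0∞} (hg : Monotone g) (y : S) :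
    leftSup g ((y : ℝ) : EReal) = g y := by
  apply le_antisymm
  · exact iSup₂_le fun z hz => hg (by exact_mod_cast hz)
  · exact le_iSup₂ (f := fun (z : S) (_ : ((z : ℝ) : EReal) ≤ ((y : ℝ) : EReal)) => g z) y le_rfl

/-- The expectation of `g` at the running supremum of `p` at a random time with law `μ`. -/
noncomputable def pathReward (g : S → ℝ≥0∞) (μ : Measure ℝ≥0) (p : ℚ≥0 → S) : ℝ≥0∞ :=
  ∫⁻ r, leftSup g (pathSup p r) ∂μ

theorem measurable_leftSup_pathSup (g : S → ℝ≥0∞) :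
    Measurable fun z : (ℚ≥0 → S) × ℝ≥0 => leftSup g (pathSup z.1 z.2) :=
  (monotone_leftSup g).measurable.comp measurable_pathSup

theorem measurable_pathReward (g : S → ℝ≥0∞) (μ : Measure ℝ≥0) [SFinite μ] :
    Measurable (pathReward g μ) :=
  (measurable_leftSup_pathSup g).lintegral_prod_right'

theorem measurable_leftSup_pathSup_apply (g : S → ℝ≥0∞) (p : ℚ≥0 → S) :
    Measurable fun r => leftSup g (pathSup p r) := by
  have h : Measurable fun r : ℝ≥0 => ((p, r) : (ℚ≥0 → S) × ℝ≥0) := measurable_prodMk_left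
  simpa only [Function.comp_def] using (measurable_leftSup_pathSup g).comp h

end PathSup

/-! ### Progressive measurability and grids of times -/

/-- A right-continuous adapted process is progressively measurable, on a single interval. -/
theorem stronglyMeasurable_uncurry_Iic_of_rightCts {Ω E : Type*} [MeasurableSpace Ω]
    [TopologicalSpace E] [TopologicalSpace.PseudoMetrizableSpace E] [SecondCountableTopology E]
    [MeasurableSpace E] [BorelSpace E] {Y : ℝ≥0 → Ω → E} {t : ℝ≥0}
    (hY : ∀ s ≤ t, Measurable (Y s))
    (hc : ∀ ω s, Tendsto (fun r => Y r ω) (𝓝[>] s) (𝓝 (Y s ω))) :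
    StronglyMeasurable fun p : Iic t × Ω => Y p.1 p.2 := by
  -- The time `s` is replaced by the next point of the grid of mesh `1 / (n + 1)`, cut off at `t`.
  let a : ℕ → ℝ≥0 → ℝ≥0 := fun n s => ((⌊((n : ℝ≥0) + 1) * s⌋₊ : ℝ≥0) + 1) / ((n : ℝ≥0) + 1)
  have ha1 : ∀ n s, s < a n s := by
    intro n s
    rw [lt_div_iff₀ (by positivity), mul_comm]
    exact Nat.lt_floor_add_one _
  have ha2 : ∀ n s, a n s ≤ s + 1 / ((n : ℝ≥0) + 1) := by
    intro n s
    have hn : (n : ℝ≥0) + 1 ≠ 0 := by positivity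
    rw [div_le_iff₀ (by positivity), add_mul s, one_div, inv_mul_cancel₀ hn, mul_comm s]
    gcongr
    exact Nat.floor_le (by positivity)
  have hat : ∀ s, Tendsto (fun n => a n s) atTop (𝓝 s) := by
    intro s
    refine tendsto_of_tendsto_of_tendsto_of_le_of_le tendsto_const_nhds ?_
      (fun n => (ha1 n s).le) (fun n => ha2 n s)
    simpa using (tendsto_const_nhds (x := s)).add
      (tendsto_one_div_add_atTop_nhds_zero_nat (𝕜 := ℝ≥0))
  refine stronglyMeasurable_of_tendsto atTop
    (f := fun n (p : Iic t × Ω) => Y (min t (a n p.1)) p.2) (fun n => ?_) ?_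
  · refine Measurable.stronglyMeasurable ?_
    have h1 : Measurable fun z : ℕ × Ω => Y (min t (((z.1 : ℝ≥0) + 1) / ((n : ℝ≥0) + 1))) z.2 :=
      measurable_from_prod_countable_right fun k =>
        show Measurable (Y (min t (((k : ℝ≥0) + 1) / ((n : ℝ≥0) + 1)))) from
          hY _ (min_le_left _ _)
    have h2 : Measurable fun p : Iic t × Ω => ((n : ℝ≥0) + 1) * (p.1 : ℝ≥0) :=
      (measurable_subtype_coe.comp measurable_fst).const_mul _
    have h3 : Measurable fun p : Iic t × Ω => (⌊((n : ℝ≥0) + 1) * (p.1 : ℝ≥0)⌋₊, p.2) :=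
      (Nat.measurable_floor.comp h2).prodMk measurable_snd
    have h4 := h1.comp h3
    simp only [Function.comp_def] at h4
    simp only [a]
    exact h4
  · refine tendsto_pi_nhds.2 fun p => ?_
    obtain ⟨⟨s, hs⟩, ω⟩ := p
    rcases eq_or_lt_of_le (show s ≤ t from hs) with rfl | hs
    · simp only [min_eq_left (ha1 _ _).le]
      exact tendsto_const_nhds
    · refine (hc ω s).comp (tendsto_nhdsWithin_iff.2 ⟨?_, Eventually.of_forall fun n =>
        lt_min hs (ha1 n s)⟩)
      simpa [min_eq_right hs.le] using (tendsto_const_nhds (x := t)).min (hat s)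

/-- Finitely many rational times lie on a common grid. -/
theorem exists_grid (I : Finset ℚ≥0) :
    ∃ (δ : ℝ≥0) (N : ℕ), ∀ i ∈ I, ∃ k ≤ N, (i : ℝ≥0) = k * δ := by
  have h : ∀ i ∈ I, ∃ k : ℕ, (i : ℝ≥0) = k * (1 / ((∏ j ∈ I, j.den : ℕ) : ℝ≥0)) := by
    intro i hi
    obtain ⟨c, hc⟩ := Finset.dvd_prod_of_mem (fun j : ℚ≥0 => j.den) hi
    have hD : (∏ j ∈ I, j.den) ≠ 0 := Finset.prod_ne_zero_iff.2 fun j _ => j.den_ne_zero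
    refine ⟨i.num * c, ?_⟩
    rw [NNRat.cast_def, hc]
    rw [hc] at hD
    have h1 : (i.den : ℝ≥0) ≠ 0 := by exact_mod_cast left_ne_zero_of_mul hD
    have h2 : (c : ℝ≥0) ≠ 0 := by exact_mod_cast right_ne_zero_of_mul hD
    push_cast
    field_simp
  choose! k hk using h
  exact ⟨_, I.sup k, fun i hi => ⟨k i, Finset.le_sup hi, hk i hi⟩⟩

theorem withTop_add_coe_ne_top_iff {a : WithTop ℝ≥0} {δ : ℝ≥0} :
    a + (δ : WithTop ℝ≥0) ≠ ⊤ ↔ a ≠ ⊤ := by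
  rw [ne_eq, WithTop.add_eq_top]
  exact not_congr (or_iff_left WithTop.coe_ne_top)

theorem withTop_untopA_coe (t : ℝ≥0) : (t : WithTop ℝ≥0).untopA = t :=
  WithTop.untopD_coe _ t

theorem withTop_untopA_add_coe {a : WithTop ℝ≥0} (h : a ≠ ⊤) (δ : ℝ≥0) :
    (a + (δ : WithTop ℝ≥0)).untopA = a.untopA + δ := by
  lift a to ℝ≥0 using h
  rw [← WithTop.coe_add, withTop_untopA_coe, withTop_untopA_coe]

theorem isStoppingTime_add_const_nnreal {Ω : Type*} {m : MeasurableSpace Ω}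
    {𝓕 : Filtration ℝ≥0 m} {τ : Ω → WithTop ℝ≥0} (hτ : IsStoppingTime 𝓕 τ) (δ : ℝ≥0) :
    IsStoppingTime 𝓕 fun ω => τ ω + δ := by
  intro t
  rcases le_or_gt δ t with h | h
  · have : {ω | τ ω + δ ≤ t} = {ω | τ ω ≤ ((t - δ : ℝ≥0) : WithTop ℝ≥0)} := by
      ext ω
      change τ ω + δ ≤ t ↔ τ ω ≤ _
      cases τ ω with
      | top =>
        rw [WithTop.top_add]
        exact iff_of_false (WithTop.not_top_le_coe _) (WithTop.not_top_le_coe _)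
      | coe a => norm_cast; rw [le_tsub_iff_right h]
    rw [this]
    exact 𝓕.mono tsub_le_self _ (hτ (t - δ))
  · have : {ω | τ ω + δ ≤ t} = ∅ := by
      ext ω
      refine iff_of_false (not_le.2 (show (t : WithTop ℝ≥0) < τ ω + δ from ?_)) (notMem_empty _)
      cases τ ω with
      | top => rw [WithTop.top_add]; exact WithTop.coe_lt_top t
      | coe a => norm_cast; exact h.trans_le le_add_self
    rw [this]
    exact @MeasurableSet.empty _ (𝓕 t)

/-- A function exceeds its supremum over everything to the left at countably many points only. -/
theorem countable_setOf_iSup_lt {S : Set ℝ} (g : S → ℝ≥0∞) :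
    {a : S | ⨆ (y : S) (_ : y < a), g y < g a}.Countable := by
  have h : ∀ a : {a : S | ⨆ (y : S) (_ : y < a), g y < g a}, ∃ q : ℝ≥0, ∃ p : ℚ≥0, q = p ∧
      ⨆ (y : S) (_ : y < a.1), g y < q ∧ (q : ℝ≥0∞) < g a.1 := by
    rintro ⟨a, ha⟩
    obtain ⟨u, hu, hu'⟩ := ENNReal.lt_iff_exists_nnreal_btwn.1 (show _ < _ from ha)
    obtain ⟨v, hv, hv'⟩ := ENNReal.lt_iff_exists_nnreal_btwn.1 hu'
    obtain ⟨p, hp, hp'⟩ := exists_nnrat_btwn (ENNReal.coe_lt_coe.1 hv)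
    exact ⟨p, p, rfl, hu.trans (ENNReal.coe_lt_coe.2 hp), (ENNReal.coe_lt_coe.2 hp').trans hv'⟩
  choose q p hqp h1 h2 using h
  have hlt : ∀ a b, a < b → q a < q b := by
    intro a b hab
    refine ENNReal.coe_lt_coe.1 ((h2 a).trans_le (le_trans ?_ (h1 b).le))
    exact le_iSup₂ (f := fun (y : S) (_ : y < b.1) => g y) a.1 hab
  have hinj : Function.Injective p := by
    intro a b hab
    have hq : q a = q b := by rw [hqp, hqp, hab]
    rcases lt_trichotomy a b with h | h | h
    · exact absurd hq (hlt a b h).ne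
    · exact h
    · exact absurd hq (hlt b a h).ne'
  exact countable_coe_iff.1 hinj.countable

namespace HuntProcess

variable {S : Set ℝ} {Ω : Type*} [MeasurableSpace Ω] (H : HuntProcess S Ω)

/-! ### The strong Markov property for paths -/

theorem measurable_X (t : ℝ≥0) : Measurable (H.X t) :=
  (H.adapted t).mono (H.𝓕.le t) le_rfl

theorem isStronglyProgressive : IsStronglyProgressive H.𝓕 H.X := fun t =>
  @stronglyMeasurable_uncurry_Iic_of_rightCts Ω S (H.𝓕 t) _ _ _ _ _ H.X t
    (fun s hs => (H.adapted s).mono (H.𝓕.mono hs) le_rfl) H.right_cts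

theorem measurable_stoppedValue_of_isStoppingTime {τ : Ω → WithTop ℝ≥0}
    (hτ : IsStoppingTime H.𝓕 τ) :
    Measurable (stoppedValue H.X τ) :=
  (measurable_stoppedValue H.isStronglyProgressive hτ).mono hτ.measurableSpace_le le_rfl

theorem measurableSet_ne_top {τ : Ω → WithTop ℝ≥0} (hτ : IsStoppingTime H.𝓕 τ) :
    MeasurableSet {ω | τ ω ≠ ⊤} :=
  hτ.measurableSet_eq_top.compl

/-- The path at rational times after time `t`. -/
def pathFrom (t : ℝ≥0) (ω : Ω) : ℚ≥0 → S := fun q => H.X (t + q) ω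

/-- The path at rational times after the random time `τ`. -/
noncomputable def shiftedPath (τ : Ω → WithTop ℝ≥0) (ω : Ω) : ℚ≥0 → S :=
  fun q => stoppedValue H.X (fun ω => τ ω + ((q : ℝ≥0) : WithTop ℝ≥0)) ω

theorem measurable_pathFrom (t : ℝ≥0) : Measurable (H.pathFrom t) :=
  measurable_pi_lambda _ fun _ => H.measurable_X _

theorem measurable_shiftedPath {τ : Ω → WithTop ℝ≥0} (hτ : IsStoppingTime H.𝓕 τ) :
    Measurable (H.shiftedPath τ) :=
  measurable_pi_lambda _ fun q =>
    H.measurable_stoppedValue_of_isStoppingTime (isStoppingTime_add_const_nnreal hτ (q : ℝ≥0))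

theorem stoppedValue_add_const {τ : Ω → WithTop ℝ≥0} {ω : Ω} (h : τ ω ≠ ⊤) (δ : ℝ≥0) :
    stoppedValue H.X (fun ω => τ ω + δ) ω = H.X ((τ ω).untopA + δ) ω := by
  simp only [stoppedValue, withTop_untopA_add_coe h]

theorem shiftedPath_eq {τ : Ω → WithTop ℝ≥0} {ω : Ω} (h : τ ω ≠ ⊤) :
    H.shiftedPath τ ω = H.pathFrom (τ ω).untopA ω :=
  funext fun q => H.stoppedValue_add_const h q

/-- The transition kernel over a time `t`. -/
noncomputable def transition (t : ℝ≥0) : Kernel S S where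
  toFun y := (H.P y).map (H.X t)
  measurable' := by
    refine Measure.measurable_of_measurable_coe _ fun B hB => ?_
    simp only [Measure.map_apply (H.measurable_X t) hB]
    exact H.measurable_transition t B hB

/-- The strong Markov property for a function of the state at a single later time. -/
theorem setLIntegral_X_add {τ : Ω → WithTop ℝ≥0} (hτ : IsStoppingTime H.𝓕 τ) {A : Set Ω}
    (hA : MeasurableSet[hτ.measurableSpace] A) (δ : ℝ≥0) {φ : S → ℝ≥0∞} (hφ : Measurable φ)
    (x : S) :
    ∫⁻ ω in A ∩ {ω | τ ω ≠ ⊤}, φ (stoppedValue H.X (fun ω => τ ω + δ) ω) ∂H.P x =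
      ∫⁻ ω in A ∩ {ω | τ ω ≠ ⊤}, ∫⁻ ω', φ (H.X δ ω') ∂H.P (stoppedValue H.X τ ω) ∂H.P x := by
  have hm1 := H.measurable_stoppedValue_of_isStoppingTime (isStoppingTime_add_const_nnreal hτ δ)
  have hm0 := H.measurable_stoppedValue_of_isStoppingTime hτ
  have hE : MeasurableSet (A ∩ {ω | τ ω ≠ ⊤}) :=
    (hτ.measurableSpace_le _ hA).inter (H.measurableSet_ne_top hτ)
  set E := A ∩ {ω | τ ω ≠ ⊤}
  have hlaw : ((H.P x).restrict E).map (stoppedValue H.X fun ω => τ ω + δ) =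
      (((H.P x).restrict E).map (stoppedValue H.X τ)).bind (H.transition δ) := by
    ext B hB
    rw [Measure.map_apply hm1 hB, Measure.restrict_apply (hm1 hB),
      Measure.bind_apply hB (Kernel.aemeasurable _),
      lintegral_map (Kernel.measurable_coe _ hB) hm0]
    have h1 : ∀ y, H.transition δ y B = H.P y {ω' | H.X δ ω' ∈ B} := fun y =>
      Measure.map_apply (H.measurable_X δ) hB
    simp only [h1]
    rw [← H.strong_markov τ hτ A hA δ B hB x]
    congr 1
    ext ω
    constructor
    · rintro ⟨h, hω⟩
      refine ⟨hω, ?_⟩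
      rw [mem_preimage, H.stoppedValue_add_const hω.2] at h
      exact h
    · rintro ⟨hω, h⟩
      refine ⟨?_, hω⟩
      rw [mem_preimage, H.stoppedValue_add_const hω.2]
      exact h
  rw [← lintegral_map hφ hm1, hlaw, Measure.lintegral_bind (Kernel.aemeasurable _) hφ.aemeasurable,
    lintegral_map hφ.lintegral_kernel hm0]
  refine lintegral_congr fun ω => ?_
  exact lintegral_map hφ (H.measurable_X δ)

/-- The probability, from each starting point, that the process lies in `B k` at time `k δ` for all
`k ≤ N`, in terms of the transition kernel. -/
noncomputable def gridProb (δ : ℝ≥0) : ℕ → (ℕ → Set S) → S → ℝ≥0∞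
  | 0, B => (B 0).indicator 1
  | N + 1, B => (B 0).indicator fun y => ∫⁻ ω, gridProb δ N (fun k => B (k + 1)) (H.X δ ω) ∂H.P y

theorem measurable_gridProb (δ : ℝ≥0) (N : ℕ) (B : ℕ → Set S) (hB : ∀ k, MeasurableSet (B k)) :
    Measurable (H.gridProb δ N B) := by
  induction N generalizing B with
  | zero => exact measurable_one.indicator (hB 0)
  | succ N ih =>
    refine Measurable.indicator ?_ (hB 0)
    have h := ih (fun k => B (k + 1)) fun k => hB _
    have h1 := h.lintegral_kernel (κ := H.transition δ)
    have h2 : ∀ y, ∫⁻ z, H.gridProb δ N (fun k => B (k + 1)) z ∂H.transition δ y =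
        ∫⁻ ω, H.gridProb δ N (fun k => B (k + 1)) (H.X δ ω) ∂H.P y :=
      fun y => lintegral_map h (H.measurable_X δ)
    simpa only [h2] using h1

/-- The strong Markov property on a grid of times, by induction on the number of times: the first
constraint is absorbed into the event before the stopping time, which then moves on by one step. -/
theorem measure_grid_eq (δ : ℝ≥0) (N : ℕ) (B : ℕ → Set S) (hB : ∀ k, MeasurableSet (B k))
    {τ : Ω → WithTop ℝ≥0} (hτ : IsStoppingTime H.𝓕 τ) {A : Set Ω}
    (hA : MeasurableSet[hτ.measurableSpace] A) (x : S) :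
    H.P x (A ∩ {ω | τ ω ≠ ⊤} ∩ {ω | ∀ k ≤ N, H.X ((τ ω).untopA + k * δ) ω ∈ B k}) =
      ∫⁻ ω in A ∩ {ω | τ ω ≠ ⊤}, H.gridProb δ N B (stoppedValue H.X τ ω) ∂H.P x := by
  induction N generalizing B τ A with
  | zero =>
    have hm0 := H.measurable_stoppedValue_of_isStoppingTime hτ
    have h1 : ∀ ω, H.gridProb δ 0 B (stoppedValue H.X τ ω) =
      (stoppedValue H.X τ ⁻¹' B 0).indicator 1 ω := fun ω => rfl
    simp only [h1]
    rw [lintegral_indicator_one (hm0 (hB 0)), Measure.restrict_apply (hm0 (hB 0)), inter_comm]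
    congr 2
    ext ω
    simp [stoppedValue]
  | succ N ih =>
    have hm0 := H.measurable_stoppedValue_of_isStoppingTime hτ
    have hτ' := isStoppingTime_add_const_nnreal hτ δ
    have hA0 : MeasurableSet[hτ.measurableSpace] (A ∩ stoppedValue H.X τ ⁻¹' B 0) :=
      hA.inter (measurable_stoppedValue H.isStronglyProgressive hτ (hB 0))
    have hle : hτ.measurableSpace ≤ hτ'.measurableSpace :=
      IsStoppingTime.measurableSpace_mono hτ hτ' fun ω => le_self_add
    have h1 := ih (fun k => B (k + 1)) (fun k => hB _) hτ' (hle _ hA0)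
    have htop : {ω | τ ω + (δ : WithTop ℝ≥0) ≠ ⊤} = {ω | τ ω ≠ ⊤} := by
      ext ω; exact withTop_add_coe_ne_top_iff
    rw [htop, H.setLIntegral_X_add hτ hA0 δ (H.measurable_gridProb δ N _ fun k => hB _) x] at h1
    have h2 : ∀ ω, H.gridProb δ (N + 1) B (stoppedValue H.X τ ω) =
      (stoppedValue H.X τ ⁻¹' B 0).indicator (fun ω =>
        ∫⁻ ω', H.gridProb δ N (fun k => B (k + 1)) (H.X δ ω') ∂H.P (stoppedValue H.X τ ω)) ω :=
      fun ω => rfl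
    simp only [h2]
    rw [lintegral_indicator (hm0 (hB 0)), Measure.restrict_restrict (hm0 (hB 0))]
    have h3 : stoppedValue H.X τ ⁻¹' B 0 ∩ (A ∩ {ω | τ ω ≠ ⊤}) =
        A ∩ stoppedValue H.X τ ⁻¹' B 0 ∩ {ω | τ ω ≠ ⊤} := by
      ext ω; simp only [mem_inter_iff]; tauto
    rw [h3, ← h1]
    congr 1
    ext ω
    have h4 : τ ω ≠ ⊤ → ((τ ω + (δ : WithTop ℝ≥0)).untopA = (τ ω).untopA + δ) :=
      fun h => withTop_untopA_add_coe h δ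
    constructor
    · rintro ⟨⟨hωA, hωt⟩, hω⟩
      refine ⟨⟨⟨hωA, ?_⟩, hωt⟩, fun k hk => ?_⟩
      · simpa [stoppedValue] using hω 0 (Nat.zero_le _)
      · have := hω (k + 1) (by omega)
        rw [h4 hωt]
        push_cast at this
        rwa [add_mul, one_mul, add_comm _ δ, ← add_assoc] at this
    · rintro ⟨⟨⟨hωA, hω0⟩, hωt⟩, hω⟩
      refine ⟨⟨hωA, hωt⟩, fun k hk => ?_⟩
      rcases k with _ | k
      · simpa [stoppedValue] using hω0
      · have := hω k (by omega)
        rw [h4 hωt] at this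
        push_cast
        rwa [add_mul, one_mul, add_comm _ δ, ← add_assoc]

theorem gridProb_eq (δ : ℝ≥0) (N : ℕ) (B : ℕ → Set S) (hB : ∀ k, MeasurableSet (B k)) (x : S) :
    H.gridProb δ N B x = H.P x {ω | ∀ k ≤ N, H.X (k * δ) ω ∈ B k} := by
  have := H.isProbabilityMeasure x
  have h := H.measure_grid_eq δ N B hB (isStoppingTime_const H.𝓕 (0 : ℝ≥0)) MeasurableSet.univ x
  have h0 : {ω : Ω | ((0 : ℝ≥0) : WithTop ℝ≥0) ≠ ⊤} = univ :=
    eq_univ_of_forall fun _ => WithTop.coe_ne_top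
  simp only [h0, withTop_untopA_coe, zero_add, univ_inter, Measure.restrict_univ] at h
  rw [h]
  have h2 : ∀ᵐ ω ∂H.P x, H.gridProb δ N B
      (stoppedValue H.X (fun _ => ((0 : ℝ≥0) : WithTop ℝ≥0)) ω) = H.gridProb δ N B x := by
    filter_upwards [H.start x] with ω hω
    exact congrArg _ hω
  rw [lintegral_congr_ae h2]
  simp

instance (x : S) : IsProbabilityMeasure (H.P x) := H.isProbabilityMeasure x

/-- A cylinder over rational times constrains a path on a grid only. -/
theorem exists_grid_cylinder (I : Finset ℚ≥0) (C : ℚ≥0 → Set S) (hC : ∀ i, MeasurableSet (C i)) :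
    ∃ (δ : ℝ≥0) (N : ℕ) (B : ℕ → Set S), (∀ k, MeasurableSet (B k)) ∧ ∀ t ω,
      H.pathFrom t ω ∈ (I : Set ℚ≥0).pi C ↔ ∀ k ≤ N, H.X (t + k * δ) ω ∈ B k := by
  obtain ⟨δ, N, hI⟩ := exists_grid I
  refine ⟨δ, N, fun k => ⋂ i ∈ I, ⋂ (_ : (i : ℝ≥0) = k * δ), C i, fun k => ?_, fun t ω => ?_⟩
  · exact Finset.measurableSet_biInter I fun i _ => MeasurableSet.iInter fun _ => hC i
  · simp only [Set.mem_pi, mem_iInter, Finset.mem_coe]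
    constructor
    · intro h k _ i hi hik
      rw [← hik]
      exact h i hi
    · intro h i hi
      obtain ⟨k, hk, hik⟩ := hI i hi
      have := h k hk i hi hik
      rw [← hik] at this
      exact this

theorem map_pathFrom_zero_pi {I : Finset ℚ≥0} {C : ℚ≥0 → Set S} {δ : ℝ≥0} {N : ℕ} {B : ℕ → Set S}
    (hC : MeasurableSet ((I : Set ℚ≥0).pi C)) (hB : ∀ k, MeasurableSet (B k))
    (h : ∀ t ω, H.pathFrom t ω ∈ (I : Set ℚ≥0).pi C ↔ ∀ k ≤ N, H.X (t + k * δ) ω ∈ B k) (y : S) :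
    (H.P y).map (H.pathFrom 0) ((I : Set ℚ≥0).pi C) = H.gridProb δ N B y := by
  rw [Measure.map_apply (H.measurable_pathFrom 0) hC, H.gridProb_eq δ N B hB]
  congr 1
  ext ω
  simpa using h 0 ω

theorem isPiSystem_cylinders :
    IsPiSystem (squareCylinders fun _ : ℚ≥0 => {s : Set S | MeasurableSet s}) :=
  isPiSystem_squareCylinders (fun _ => MeasurableSpace.isPiSystem_measurableSet)
    fun _ => (MeasurableSet.univ : MeasurableSet (univ : Set S))

/-- The law of the path at rational times, as a kernel in the starting point. -/
noncomputable def pathKernel : Kernel S (ℚ≥0 → S) where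
  toFun y := (H.P y).map (H.pathFrom 0)
  measurable' := by
    have : ∀ y, IsProbabilityMeasure ((H.P y).map (H.pathFrom 0)) := fun y =>
      Measure.isProbabilityMeasure_map (H.measurable_pathFrom 0).aemeasurable
    refine Measurable.measure_of_isPiSystem_of_isProbabilityMeasure
      (generateFrom_squareCylinders (ι := ℚ≥0) (α := fun _ => S)).symm isPiSystem_cylinders ?_
    rintro _ ⟨I, C, hC, rfl⟩
    have hC' : ∀ i, MeasurableSet (C i) := fun i => hC i (mem_univ i)
    obtain ⟨δ, N, B, hB, hcyl⟩ := H.exists_grid_cylinder I C hC'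
    have hm : MeasurableSet ((I : Set ℚ≥0).pi C) :=
      MeasurableSet.pi I.countable_toSet fun i _ => hC' i
    simp only [H.map_pathFrom_zero_pi hm hB hcyl]
    exact H.measurable_gridProb δ N B hB

/-- The strong Markov property for the whole path after a stopping time. -/
theorem map_shiftedPath {τ : Ω → WithTop ℝ≥0} (hτ : IsStoppingTime H.𝓕 τ) {A : Set Ω}
    (hA : MeasurableSet[hτ.measurableSpace] A) (x : S) :
    ((H.P x).restrict (A ∩ {ω | τ ω ≠ ⊤})).map (H.shiftedPath τ) =
      (((H.P x).restrict (A ∩ {ω | τ ω ≠ ⊤})).map (stoppedValue H.X τ)).bind H.pathKernel := by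
  have hm0 := H.measurable_stoppedValue_of_isStoppingTime hτ
  have hms := H.measurable_shiftedPath hτ
  have key : ∀ (I : Finset ℚ≥0) (C : ℚ≥0 → Set S), (∀ i, MeasurableSet (C i)) →
      ((H.P x).restrict (A ∩ {ω | τ ω ≠ ⊤})).map (H.shiftedPath τ) ((I : Set ℚ≥0).pi C) =
        (((H.P x).restrict (A ∩ {ω | τ ω ≠ ⊤})).map (stoppedValue H.X τ)).bind H.pathKernel
          ((I : Set ℚ≥0).pi C) := by
    intro I C hC
    obtain ⟨δ, N, B, hB, hcyl⟩ := H.exists_grid_cylinder I C hC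
    have hm : MeasurableSet ((I : Set ℚ≥0).pi C) :=
      MeasurableSet.pi I.countable_toSet fun i _ => hC i
    have h1 : ∀ y, H.pathKernel y ((I : Set ℚ≥0).pi C) = H.gridProb δ N B y :=
      H.map_pathFrom_zero_pi hm hB hcyl
    rw [Measure.map_apply hms hm, Measure.restrict_apply (hms hm),
      Measure.bind_apply hm (Kernel.aemeasurable _),
      lintegral_map (Kernel.measurable_coe _ hm) hm0]
    simp only [h1]
    rw [← H.measure_grid_eq δ N B hB hτ hA x, inter_comm]
    congr 1
    ext ω
    refine and_congr_right fun hω => ?_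
    rw [mem_preimage, H.shiftedPath_eq hω.2, hcyl]
    rfl
  refine ext_of_generate_finite _
    (generateFrom_squareCylinders (ι := ℚ≥0) (α := fun _ => S)).symm isPiSystem_cylinders ?_ ?_
  · rintro _ ⟨I, C, hC, rfl⟩
    exact key I C fun i => hC i (mem_univ i)
  · simpa using key ∅ (fun _ => univ) fun _ => MeasurableSet.univ

/-- The strong Markov property with a weight that is known at the stopping time. -/
theorem lintegral_mul_shiftedPath {τ : Ω → WithTop ℝ≥0} (hτ : IsStoppingTime H.𝓕 τ)
    {w : Ω → ℝ≥0∞} (hw : Measurable[hτ.measurableSpace] w)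
    {Ψ : (ℚ≥0 → S) → ℝ≥0∞} (hΨ : Measurable Ψ) (x : S) :
    ∫⁻ ω in {ω | τ ω ≠ ⊤}, w ω * Ψ (H.shiftedPath τ ω) ∂H.P x =
      ∫⁻ ω in {ω | τ ω ≠ ⊤},
        w ω * ∫⁻ ω', Ψ (H.pathFrom 0 ω') ∂H.P (stoppedValue H.X τ ω) ∂H.P x := by
  have hm0 := H.measurable_stoppedValue_of_isStoppingTime hτ
  have hms := H.measurable_shiftedPath hτ
  have hR : Measurable fun y => ∫⁻ ω', Ψ (H.pathFrom 0 ω') ∂H.P y := by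
    have h1 := hΨ.lintegral_kernel (κ := H.pathKernel)
    have h2 : ∀ y, ∫⁻ p, Ψ p ∂H.pathKernel y = ∫⁻ ω', Ψ (H.pathFrom 0 ω') ∂H.P y :=
      fun y => lintegral_map hΨ (H.measurable_pathFrom 0)
    simpa only [h2] using h1
  refine lintegral_mul_eq_of_forall_setLIntegral_eq hτ.measurableSpace_le (hΨ.comp hms)
    (hR.comp hm0) (fun A hA => ?_) hw
  rw [Measure.restrict_restrict (hτ.measurableSpace_le _ hA)]
  simp only [Function.comp_apply]
  rw [← lintegral_map hΨ hms, H.map_shiftedPath hτ hA x,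
    Measure.lintegral_bind (Kernel.aemeasurable _) hΨ.aemeasurable,
    lintegral_map hΨ.lintegral_kernel hm0]
  exact lintegral_congr fun ω => lintegral_map hΨ (H.measurable_pathFrom 0)

/-! ### The maximum functional -/

theorem pathSup_pathFrom (t r : ℝ≥0) (ω : Ω) :
    pathSup (H.pathFrom t ω) r = ⨆ (s : ℝ≥0) (_ : s ≤ r), ((H.X (t + s) ω : ℝ) : EReal) := by
  refine pathSup_eq_iSup (fun s => H.X (t + s) ω) (fun s => (H.right_cts ω (t + s)).comp ?_) r
  refine tendsto_nhdsWithin_iff.2 ⟨?_, ?_⟩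
  · exact ((continuous_const.add continuous_id).tendsto s).mono_left nhdsWithin_le_nhds
  · filter_upwards [self_mem_nhdsWithin] with r hr
    exact add_lt_add_right (show s < r from hr) t

theorem X_le_runningMax (ω : Ω) {s r : ℝ≥0} (h : s ≤ r) : H.X s ω ≤ H.runningMax r ω :=
  le_csSup (H.bddAbove_path ω r) ⟨s, h, rfl⟩

theorem exists_lt_X_of_lt_runningMax {ω : Ω} {r : ℝ≥0} {c : ℝ} (h : c < H.runningMax r ω) :
    ∃ s ≤ r, c < H.X s ω := by
  obtain ⟨_, ⟨s, hs, rfl⟩, hs'⟩ := exists_lt_of_lt_csSup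
    (s := (fun s => (H.X s ω : ℝ)) '' Iic r) ⟨_, 0, mem_Iic.2 zero_le, rfl⟩ h
  exact ⟨s, hs, hs'⟩

theorem pathSup_pathFrom_zero (r : ℝ≥0) (ω : Ω) :
    pathSup (H.pathFrom 0 ω) r = ((H.runningMax r ω : ℝ) : EReal) := by
  rw [H.pathSup_pathFrom]
  simp only [zero_add]
  apply le_antisymm
  · refine iSup₂_le fun s hs => ?_
    exact_mod_cast H.X_le_runningMax ω hs
  · refine le_of_forall_lt fun c hc => ?_
    obtain ⟨a, ha, ha'⟩ := EReal.lt_iff_exists_real_btwn.1 hc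
    obtain ⟨s, hs, hs'⟩ := H.exists_lt_X_of_lt_runningMax (EReal.coe_lt_coe_iff.1 ha')
    exact (ha.trans (EReal.coe_lt_coe_iff.2 hs')).trans_le
      (le_iSup₂ (f := fun (s : ℝ≥0) (_ : s ≤ r) => ((H.X s ω : ℝ) : EReal)) s hs)

/-- The expectation from `y` of `g` at the running maximum at an independent time with law `μ`. -/
noncomputable def maxReward (g : S → ℝ≥0∞) (μ : Measure ℝ≥0) (y : S) : ℝ≥0∞ :=
  ∫⁻ ω, pathReward g μ (H.pathFrom 0 ω) ∂H.P y

theorem maxReward_eq {g : S → ℝ≥0∞} (hg : Monotone g) (μ : Measure ℝ≥0) (y : S) :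
    H.maxReward g μ y = ∫⁻ ω, ∫⁻ r, g (H.runningMax r ω) ∂μ ∂H.P y := by
  unfold maxReward pathReward
  simp only [H.pathSup_pathFrom_zero, leftSup_coe hg]

/-- Discounting at a stopping time and starting afresh from there amounts to looking at the running
maximum after the stopping time only, up to an independent exponential time that exceeds it. -/
theorem setLIntegral_exp_mul_maxReward {β : ℝ} {μ : Measure ℝ≥0} [SFinite μ]
    (hμ : μ.map ((↑) : ℝ≥0 → ℝ) = expMeasure β) (g : S → ℝ≥0∞) {τ : Ω → WithTop ℝ≥0}
    (hτ : IsStoppingTime H.𝓕 τ) (x : S) :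
    ∫⁻ ω in {ω | τ ω ≠ ⊤}, ENNReal.ofReal (Real.exp (-β * (τ ω).untopA)) *
        H.maxReward g μ (stoppedValue H.X τ ω) ∂H.P x =
      ∫⁻ ω in {ω | τ ω ≠ ⊤}, ∫⁻ u in Ioi (τ ω).untopA,
        leftSup g (pathSup (H.pathFrom (τ ω).untopA ω) (u - (τ ω).untopA)) ∂μ ∂H.P x := by
  have hw : Measurable[hτ.measurableSpace] fun ω =>
      ENNReal.ofReal (Real.exp (-β * ((τ ω).untopA : ℝ≥0))) := by
    have h1 : Measurable[hτ.measurableSpace] fun ω => ((τ ω).untopA : ℝ≥0) := hτ.measurable.untopA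
    have h2 : Measurable fun t : ℝ≥0 => ENNReal.ofReal (Real.exp (-β * t)) := by fun_prop
    exact h2.comp h1
  have h := H.lintegral_mul_shiftedPath hτ hw (measurable_pathReward g μ) x
  have h2 : ∀ ω, τ ω ≠ ⊤ → ENNReal.ofReal (Real.exp (-β * ((τ ω).untopA : ℝ≥0))) *
      pathReward g μ (H.shiftedPath τ ω) = ∫⁻ u in Ioi (τ ω).untopA,
        leftSup g (pathSup (H.pathFrom (τ ω).untopA ω) (u - (τ ω).untopA)) ∂μ := by
    intro ω hω
    rw [H.shiftedPath_eq hω]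
    exact exp_mul_lintegral_eq_setLIntegral_Ioi hμ _ (measurable_leftSup_pathSup_apply g _)
  have h3 := setLIntegral_congr_fun (μ := H.P x) (H.measurableSet_ne_top hτ)
    (f := fun ω => ENNReal.ofReal (Real.exp (-β * ((τ ω).untopA : ℝ≥0))) *
      pathReward g μ (H.shiftedPath τ ω))
    (g := fun ω => ∫⁻ u in Ioi (τ ω).untopA,
        leftSup g (pathSup (H.pathFrom (τ ω).untopA ω) (u - (τ ω).untopA)) ∂μ) (fun ω hω => h2 ω hω)
  exact h.symm.trans h3

/-! ### Hitting times and attainment of the running maximum -/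

theorem tendsto_X_nhdsGE (ω : Ω) (t : ℝ≥0) :
    Tendsto (fun s => H.X s ω) (𝓝[≥] t) (𝓝 (H.X t ω)) := by
  rw [← Ioi_insert, nhdsWithin_insert]
  exact tendsto_sup.2 ⟨tendsto_pure_left.2 fun _ => mem_of_mem_nhds, H.right_cts ω t⟩

theorem isStoppingTime_hittingAfter_of_isOpen {U : Set S} (hU : IsOpen U) :
    IsStoppingTime H.𝓕 (hittingAfter H.X U 0) := by
  have := H.rightCont_filtration
  refine isStoppingTime_of_measurableSet_lt_of_isRightContinuous fun t => ?_
  have h : {ω | hittingAfter H.X U 0 ω < t} = ⋃ (q : ℚ≥0) (_ : (q : ℝ≥0) < t), H.X q ⁻¹' U := by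
    ext ω
    refine hittingAfter_lt_iff.trans ?_
    simp only [mem_iUnion, mem_preimage, exists_prop]
    constructor
    · rintro ⟨s, ⟨-, hst⟩, hs⟩
      have h1 := (H.right_cts ω s).eventually (hU.mem_nhds hs)
      obtain ⟨u, hu, hu'⟩ := (mem_nhdsGT_iff_exists_Ioo_subset).1 h1
      obtain ⟨q, hq, hq'⟩ := exists_nnrat_btwn (lt_min hu hst)
      exact ⟨q, hq'.trans_le (min_le_right _ _), hu' ⟨hq, hq'.trans_le (min_le_left _ _)⟩⟩
    · rintro ⟨q, hq, hq'⟩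
      exact ⟨q, ⟨zero_le, hq⟩, hq'⟩
  rw [h]
  exact MeasurableSet.iUnion fun q => MeasurableSet.iUnion fun hq =>
    H.𝓕.mono hq.le _ (H.adapted q hU.measurableSet)

/-- The path is in the set at times arbitrarily shortly after the hitting time, or at that time. -/
theorem frequently_mem_of_hittingAfter_ne_top {U : Set S} {ω : Ω}
    (h : hittingAfter H.X U 0 ω ≠ ⊤) :
    ∃ᶠ s in 𝓝[≥] (hittingAfter H.X U 0 ω).untopA, H.X s ω ∈ U := by
  intro hcon
  obtain ⟨t, ht⟩ := WithTop.ne_top_iff_exists.1 h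
  rw [← ht, withTop_untopA_coe] at hcon
  obtain ⟨u, hu, hu'⟩ := (mem_nhdsGE_iff_exists_Ico_subset).1 hcon
  have hlt : hittingAfter H.X U 0 ω < (u : WithTop ℝ≥0) := by
    rw [← ht]; exact WithTop.coe_lt_coe.2 hu
  obtain ⟨s, ⟨-, hs⟩, hsU⟩ := hittingAfter_lt_iff.1 hlt
  refine hu' ⟨?_, hs⟩ hsU
  have := hittingAfter_le_of_mem (u := H.X) (n := 0) zero_le hsU
  rw [← ht] at this
  exact WithTop.coe_le_coe.1 this

theorem stoppedValue_hittingAfter_mem_closure {U : Set S} {ω : Ω}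
    (h : hittingAfter H.X U 0 ω ≠ ⊤) :
    stoppedValue H.X (hittingAfter H.X U 0) ω ∈ closure U :=
  mem_closure_of_frequently_of_tendsto (H.frequently_mem_of_hittingAfter_ne_top h)
    (H.tendsto_X_nhdsGE ω _)

/-- By quasi-left-continuity, a fixed level is almost surely attained whenever it is the running
maximum: the times at which the path comes close to it increase to a time at which the path is at
least there. -/
theorem ae_exists_le_X_of_runningMax_eq (a x : S) :
    ∀ᵐ ω ∂H.P x, ∀ r, H.runningMax r ω = a → ∃ s ≤ r, a ≤ H.X s ω := by
  let U : ℕ → Set S := fun n => {y | (a : ℝ) - 1 / ((n : ℝ) + 1) < y}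
  have hU : ∀ n, IsOpen (U n) := fun n => isOpen_lt continuous_const continuous_subtype_val
  let σ : ℕ → Ω → WithTop ℝ≥0 := fun n => hittingAfter H.X (U n) 0
  have hσ : ∀ n, IsStoppingTime H.𝓕 (σ n) := fun n =>
    H.isStoppingTime_hittingAfter_of_isOpen (hU n)
  have hlub : ∀ ω, IsLUB (range fun n => σ n ω) (⨆ n, σ n ω) := fun ω => isLUB_iSup
  have hτ : IsStoppingTime H.𝓕 fun ω => ⨆ n, σ n ω := by
    intro t
    have : {ω | ⨆ n, σ n ω ≤ (t : WithTop ℝ≥0)} = ⋂ n, {ω | σ n ω ≤ t} := by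
      ext ω
      rw [mem_iInter]
      exact iSup_le_iff (α := WithTop ℝ≥0) (f := fun n => σ n ω)
    rw [this]
    exact MeasurableSet.iInter fun n => hσ n t
  have hmono : ∀ ω, Monotone fun n => σ n ω := by
    intro ω m n hmn
    refine hittingAfter_apply_anti H.X 0 ω ?_
    intro y hy
    have h1 : 1 / ((n : ℝ) + 1) ≤ 1 / ((m : ℝ) + 1) := by gcongr
    exact lt_of_le_of_lt (sub_le_sub_left h1 _) hy
  filter_upwards [H.quasi_left_cts σ _ hσ hτ hmono hlub x] with ω hω r hr
  have hσr : ∀ n, σ n ω ≤ r := by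
    intro n
    have h1 : (a : ℝ) - 1 / ((n : ℝ) + 1) < H.runningMax r ω := by
      rw [hr]; exact sub_lt_self _ (by positivity)
    obtain ⟨s, hs, hs'⟩ := H.exists_lt_X_of_lt_runningMax h1
    exact (hittingAfter_le_of_mem zero_le hs').trans (WithTop.coe_le_coe.2 hs)
  have hτr : ⨆ n, σ n ω ≤ (r : WithTop ℝ≥0) := iSup_le hσr
  have hne : ⨆ n, σ n ω ≠ ⊤ := (hτr.trans_lt (WithTop.coe_lt_top r)).ne
  refine ⟨(⨆ n, σ n ω).untopA, ?_, ?_⟩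
  · obtain ⟨t, ht⟩ := WithTop.ne_top_iff_exists.1 hne
    rw [← ht] at hτr ⊢
    rw [withTop_untopA_coe]
    exact WithTop.coe_le_coe.1 hτr
  · have h1 : Tendsto (fun n => ((stoppedValue H.X (σ n) ω : S) : ℝ)) atTop
        (𝓝 (H.X (⨆ n, σ n ω).untopA ω : ℝ)) :=
      (continuous_subtype_val.tendsto _).comp (hω hne)
    have h2 : Tendsto (fun n : ℕ => (a : ℝ) - 1 / ((n : ℝ) + 1)) atTop (𝓝 a) := by
      simpa using (tendsto_const_nhds (x := (a : ℝ))).sub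
        (tendsto_one_div_add_atTop_nhds_zero_nat (𝕜 := ℝ))
    change (a : ℝ) ≤ (H.X (⨆ n, σ n ω).untopA ω : ℝ)
    refine le_of_tendsto_of_tendsto' h2 h1 fun n => ?_
    have h3 := H.stoppedValue_hittingAfter_mem_closure (U := U n) (ω := ω)
      ((hσr n).trans_lt (WithTop.coe_lt_top r)).ne
    have h4 : closure (U n) ⊆ {y : S | (a : ℝ) - 1 / ((n : ℝ) + 1) ≤ y} :=
      closure_minimal
        (fun y hy => (show (a : ℝ) - 1 / ((n : ℝ) + 1) < (y : ℝ) from hy).le)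
        (isClosed_le continuous_const continuous_subtype_val)
    exact h4 h3

theorem iSup_le_runningMax {g : S → ℝ≥0∞} (hg : Monotone g) (r : ℝ≥0) (ω : Ω) :
    ⨆ (s : ℝ≥0) (_ : s ≤ r), g (H.X s ω) ≤ g (H.runningMax r ω) :=
  iSup₂_le fun _ hs => hg (H.X_le_runningMax ω hs)

/-- Almost surely the supremum of a monotone function along the path is its value at the running
maximum.  This is clear where the function is left-continuous; the countably many other levels are
attained. -/
theorem ae_iSup_eq_runningMax {g : S → ℝ≥0∞} (hg : Monotone g) (x : S) :
    ∀ᵐ ω ∂H.P x, ∀ r, ⨆ (s : ℝ≥0) (_ : s ≤ r), g (H.X s ω) = g (H.runningMax r ω) := by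
  have h := (ae_ball_iff (countable_setOf_iSup_lt g)).2
    fun a _ => H.ae_exists_le_X_of_runningMax_eq a x
  filter_upwards [h] with ω hω r
  refine le_antisymm (H.iSup_le_runningMax hg r ω) ?_
  by_cases hD : ⨆ (y : S) (_ : y < H.runningMax r ω), g y < g (H.runningMax r ω)
  · obtain ⟨s, hs, hs'⟩ := hω _ hD r rfl
    exact (hg hs').trans (le_iSup₂ (f := fun (s : ℝ≥0) (_ : s ≤ r) => g (H.X s ω)) s hs)
  · refine (not_lt.1 hD).trans (iSup₂_le fun y hy => ?_)
    obtain ⟨s, hs, hs'⟩ := H.exists_lt_X_of_lt_runningMax (c := (y : ℝ)) hy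
    exact (hg (show y ≤ H.X s ω from hs'.le)).trans
      (le_iSup₂ (f := fun (s : ℝ≥0) (_ : s ≤ r) => g (H.X s ω)) s hs)

/-! ### Expectations at an independent time -/

/-- At an independent time the expectation is the iterated integral over path and time. -/
theorem lintegral_runningMax_indep {T : Ω → ℝ≥0} (hT : Measurable T) {x : S}
    (hTindep : IndepFun (fun ω t => H.X t ω) T (H.P x)) {g : S → ℝ≥0∞} (hg : Monotone g) :
    ∫⁻ ω, g (H.runningMax (T ω) ω) ∂H.P x = H.maxReward g ((H.P x).map T) x := by
  have hrestr : Measurable fun (p : ℝ≥0 → S) (q : ℚ≥0) => p (0 + q) :=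
    measurable_pi_lambda _ fun q => measurable_pi_apply _
  have hind : IndepFun (H.pathFrom 0) T (H.P x) := hTindep.comp hrestr measurable_id
  have hprod := hind.map_prod_eq_prod_map_map (H.measurable_pathFrom 0).aemeasurable hT.aemeasurable
  have hΦ := measurable_leftSup_pathSup g
  have : IsProbabilityMeasure ((H.P x).map T) := Measure.isProbabilityMeasure_map hT.aemeasurable
  calc ∫⁻ ω, g (H.runningMax (T ω) ω) ∂H.P x
      = ∫⁻ ω, leftSup g (pathSup (H.pathFrom 0 ω) (T ω)) ∂H.P x := by
        simp only [H.pathSup_pathFrom_zero, leftSup_coe hg]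
    _ = ∫⁻ z, leftSup g (pathSup z.1 z.2) ∂(H.P x).map (fun ω => (H.pathFrom 0 ω, T ω)) :=
        (lintegral_map hΦ ((H.measurable_pathFrom 0).prodMk hT)).symm
    _ = ∫⁻ p, pathReward g ((H.P x).map T) p ∂(H.P x).map (H.pathFrom 0) := by
        rw [hprod, lintegral_prod _ hΦ.aemeasurable]; rfl
    _ = H.maxReward g ((H.P x).map T) x :=
        lintegral_map (measurable_pathReward g _) (H.measurable_pathFrom 0)

theorem toENNReal_supUpTo (f : S → ℝ) (r : ℝ≥0) (ω : Ω) :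
    (H.supUpTo f r ω).toENNReal = ⨆ (s : ℝ≥0) (_ : s ≤ r), ENNReal.ofReal (f (H.X s ω)) := by
  apply le_antisymm
  · have h : H.supUpTo f r ω ≤
        ((⨆ (s : ℝ≥0) (_ : s ≤ r), ENNReal.ofReal (f (H.X s ω)) : ℝ≥0∞) : EReal) := by
      refine iSup₂_le fun s hs => ?_
      have h1 : (f (H.X s ω) : EReal) ≤ (ENNReal.ofReal (f (H.X s ω)) : EReal) := by
        rw [EReal.coe_ennreal_ofReal]
        exact_mod_cast le_max_left _ _
      exact h1.trans (EReal.coe_ennreal_le_coe_ennreal_iff.2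
        (le_iSup₂ (f := fun (s : ℝ≥0) (_ : s ≤ r) => ENNReal.ofReal (f (H.X s ω))) s hs))
    simpa using EReal.toENNReal_le_toENNReal h
  · refine iSup₂_le fun s hs => ?_
    have h := EReal.toENNReal_le_toENNReal
      (le_iSup₂ (f := fun (s : ℝ≥0) (_ : s ≤ r) => (f (H.X s ω) : EReal)) s hs)
    rwa [EReal.toENNReal_of_ne_top (EReal.coe_ne_top _), EReal.toReal_coe] at h

theorem expect_le (x : S) (Y : Ω → EReal) :
    H.expect x Y ≤ ((∫⁻ ω, (Y ω).toENNReal ∂H.P x : ℝ≥0∞) : EReal) :=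
  EReal.sub_le_of_le_add (le_add_of_nonneg_right (EReal.coe_ennreal_nonneg _))

theorem expect_eq_of_ae_nonneg {x : S} {Y : Ω → EReal} (h : ∀ᵐ ω ∂H.P x, 0 ≤ Y ω) :
    H.expect x Y = ((∫⁻ ω, (Y ω).toENNReal ∂H.P x : ℝ≥0∞) : EReal) := by
  have h1 : ∫⁻ ω, (-Y ω).toENNReal ∂H.P x = 0 := by
    rw [← lintegral_zero (μ := H.P x)]
    refine lintegral_congr_ae ?_
    filter_upwards [h] with ω hω
    exact EReal.toENNReal_of_nonpos (by simpa using hω)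
  simp [expect, h1]

/-! ### The upper bound for the value function -/

theorem discounted_eq_mul (β : ℝ) (G : S → ℝ) (t : ℝ≥0) (ω : Ω) :
    H.discounted β G t ω =
      ENNReal.ofReal (Real.exp (-β * t)) * ENNReal.ofReal (G (H.X t ω)) :=
  ENNReal.ofReal_mul (Real.exp_pos _).le

theorem payoff_of_ne_top {β : ℝ} {G : S → ℝ} {τ : Ω → WithTop ℝ≥0} {ω : Ω} (h : τ ω ≠ ⊤) :
    H.payoff β G τ ω = ENNReal.ofReal (Real.exp (-β * (τ ω).untopA)) *
      ENNReal.ofReal (G (stoppedValue H.X τ ω)) := by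
  rw [payoff, if_neg h, discounted_eq_mul]
  rfl

/-- A reward below the maximum functional yields at a stopping time after `t` at most the part of
that functional that belongs to exponential times after `t`. -/
theorem setLIntegral_payoff_le {β : ℝ} {μ : Measure ℝ≥0} [SFinite μ]
    (hμ : μ.map ((↑) : ℝ≥0 → ℝ) = expMeasure β) {g : S → ℝ≥0∞} {G : S → ℝ}
    (hG : ∀ y, ENNReal.ofReal (G y) ≤ H.maxReward g μ y) {τ : Ω → WithTop ℝ≥0}
    (hτ : IsStoppingTime H.𝓕 τ) {t : ℝ≥0} (ht : ∀ ω, (t : WithTop ℝ≥0) ≤ τ ω) (x : S) :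
    ∫⁻ ω in {ω | τ ω ≠ ⊤}, H.payoff β G τ ω ∂H.P x ≤ H.maxReward g (μ.restrict (Ioi t)) x := by
  have hmeas := H.measurableSet_ne_top hτ
  calc ∫⁻ ω in {ω | τ ω ≠ ⊤}, H.payoff β G τ ω ∂H.P x
      ≤ ∫⁻ ω in {ω | τ ω ≠ ⊤}, ENNReal.ofReal (Real.exp (-β * (τ ω).untopA)) *
          H.maxReward g μ (stoppedValue H.X τ ω) ∂H.P x := by
        refine setLIntegral_mono' hmeas fun ω hω => ?_
        rw [H.payoff_of_ne_top hω]
        exact mul_le_mul_right (hG _) _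
    _ = _ := H.setLIntegral_exp_mul_maxReward hμ g hτ x
    _ ≤ ∫⁻ ω in {ω | τ ω ≠ ⊤}, pathReward g (μ.restrict (Ioi t)) (H.pathFrom 0 ω) ∂H.P x := by
        refine setLIntegral_mono' hmeas fun ω hω => ?_
        obtain ⟨a, ha⟩ := WithTop.ne_top_iff_exists.1 hω
        have hta : t ≤ (τ ω).untopA := by
          have := ht ω
          rw [← ha] at this ⊢
          rw [withTop_untopA_coe]
          exact WithTop.coe_le_coe.1 this
        refine le_trans (setLIntegral_mono' measurableSet_Ioi fun u hu => ?_)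
          (lintegral_mono_set (Ioi_subset_Ioi hta))
        refine monotone_leftSup g ?_
        rw [H.pathSup_pathFrom, H.pathSup_pathFrom_zero]
        refine iSup₂_le fun s hs => ?_
        have h1 : (τ ω).untopA + s ≤ u := by
          rw [add_comm]; exact (le_tsub_iff_right (le_of_lt hu)).1 hs
        exact_mod_cast H.X_le_runningMax ω h1
    _ ≤ H.maxReward g (μ.restrict (Ioi t)) x := setLIntegral_le_lintegral _ _

theorem maxReward_mono_measure (g : S → ℝ≥0∞) {μ ν : Measure ℝ≥0} (h : μ ≤ ν) (x : S) :
    H.maxReward g μ x ≤ H.maxReward g ν x :=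
  lintegral_mono fun _ => lintegral_mono' h le_rfl

theorem tendsto_maxReward_restrict_Ioi {μ : Measure ℝ≥0} [IsFiniteMeasure μ] {g : S → ℝ≥0∞} {x : S}
    (h : H.maxReward g μ x ≠ ∞) :
    Tendsto (fun n : ℕ => H.maxReward g (μ.restrict (Ioi (n : ℝ≥0))) x) atTop (𝓝 0) := by
  have h0 : Tendsto (fun n : ℕ => μ (Ioi (n : ℝ≥0))) atTop (𝓝 0) := by
    have h1 := tendsto_measure_iInter_atTop (μ := μ) (s := fun n : ℕ => Ioi (n : ℝ≥0))
      (fun n => measurableSet_Ioi.nullMeasurableSet)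
      (fun m n hmn => Ioi_subset_Ioi (by exact_mod_cast hmn)) ⟨0, measure_ne_top _ _⟩
    have h2 : ⋂ n : ℕ, Ioi (n : ℝ≥0) = ∅ := by
      refine eq_empty_of_forall_notMem fun r hr => ?_
      obtain ⟨n, hn⟩ := exists_nat_ge r
      exact absurd (mem_iInter.1 hr n) (not_lt.2 hn)
    rwa [h2, measure_empty] at h1
  have hmeas := (measurable_pathReward g μ).comp (H.measurable_pathFrom 0)
  rw [← lintegral_zero (μ := H.P x)]
  refine tendsto_lintegral_of_dominated_convergence
    (bound := fun ω => pathReward g μ (H.pathFrom 0 ω)) (fun n =>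
    (measurable_pathReward g _).comp (H.measurable_pathFrom 0)) (fun n => Eventually.of_forall
    fun ω => lintegral_mono' Measure.restrict_le_self le_rfl) h ?_
  filter_upwards [ae_lt_top hmeas h] with ω hω
  exact tendsto_setLIntegral_zero hω.ne h0

theorem measurableSet_lt_discounted (β : ℝ) {G : S → ℝ} (hG : Measurable G) (ε : ℝ≥0∞) (t : ℝ≥0) :
    MeasurableSet[H.𝓕 t] {ω | ε < H.discounted β G t ω} := by
  have h : Measurable fun y => ENNReal.ofReal (Real.exp (-β * t) * G y) := by fun_prop
  exact H.adapted t (measurableSet_lt measurable_const h)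

/-- A maximal inequality on finitely many times. -/
theorem mul_measure_exists_finset_lt_discounted_le {β : ℝ} {μ : Measure ℝ≥0} [SFinite μ]
    (hμ : μ.map ((↑) : ℝ≥0 → ℝ) = expMeasure β) {g : S → ℝ≥0∞} {G : S → ℝ} (hGm : Measurable G)
    (hG : ∀ y, ENNReal.ofReal (G y) ≤ H.maxReward g μ y) (F : Finset ℚ≥0) (t : ℝ≥0) (ε : ℝ≥0∞)
    (x : S) :
    ε * H.P x {ω | ∃ q ∈ F, t ≤ q ∧ ε < H.discounted β G q ω} ≤
      H.maxReward g (μ.restrict (Ioi t)) x := by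
  classical
  -- The first of the given times after `t` at which the reward exceeds `ε`.
  let σ : Ω → WithTop ℝ≥0 := fun ω => F.inf fun q =>
    if t ≤ (q : ℝ≥0) ∧ ε < H.discounted β G q ω then ((q : ℝ≥0) : WithTop ℝ≥0) else ⊤
  have hσle : ∀ ω (s : ℝ≥0), σ ω ≤ s ↔
      ∃ q ∈ F, (t ≤ (q : ℝ≥0) ∧ ε < H.discounted β G q ω) ∧ (q : ℝ≥0) ≤ s := by
    intro ω s
    refine (Finset.inf_le_iff (WithTop.coe_lt_top s)).trans ?_
    refine exists_congr fun q => and_congr_right fun _ => ?_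
    split_ifs with h
    · exact ⟨fun h' => ⟨h, WithTop.coe_le_coe.1 h'⟩, fun h' => WithTop.coe_le_coe.2 h'.2⟩
    · exact iff_of_false (WithTop.not_top_le_coe _) fun h' => h h'.1
  have hσ : IsStoppingTime H.𝓕 σ := by
    intro s
    have : {ω | σ ω ≤ s} = ⋃ q ∈ F, ⋃ (_ : t ≤ (q : ℝ≥0)), ⋃ (_ : (q : ℝ≥0) ≤ s),
        {ω | ε < H.discounted β G q ω} := by
      ext ω
      refine (hσle ω s).trans ?_
      simp only [mem_iUnion, exists_prop]
      exact exists_congr fun q => ⟨fun h => ⟨h.1, h.2.1.1, h.2.2, h.2.1.2⟩,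
        fun h => ⟨h.1, ⟨h.2.1, h.2.2.2⟩, h.2.2.1⟩⟩
    rw [this]
    exact Finset.measurableSet_biUnion F fun q _ => MeasurableSet.iUnion fun _ =>
      MeasurableSet.iUnion fun hq => H.𝓕.mono hq _ (H.measurableSet_lt_discounted β hGm ε q)
  have hσt : ∀ ω, (t : WithTop ℝ≥0) ≤ σ ω := by
    intro ω
    refine Finset.le_inf fun q _ => ?_
    split_ifs with h
    · exact WithTop.coe_le_coe.2 h.1
    · exact le_top
  have hset : {ω | ∃ q ∈ F, t ≤ (q : ℝ≥0) ∧ ε < H.discounted β G q ω} ⊆ {ω | σ ω ≠ ⊤} := by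
    rintro ω ⟨q, hq, h⟩
    exact (((hσle ω q).2 ⟨q, hq, h, le_rfl⟩).trans_lt (WithTop.coe_lt_top _)).ne
  calc ε * H.P x {ω | ∃ q ∈ F, t ≤ q ∧ ε < H.discounted β G q ω}
      ≤ ε * H.P x {ω | σ ω ≠ ⊤} := mul_le_mul_right (measure_mono hset) _
    _ = ∫⁻ ω in {ω | σ ω ≠ ⊤}, ε ∂H.P x := (setLIntegral_const _ _).symm
    _ ≤ ∫⁻ ω in {ω | σ ω ≠ ⊤}, H.payoff β G σ ω ∂H.P x := by
        refine setLIntegral_mono' (H.measurableSet_ne_top hσ) fun ω hω => ?_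
        obtain ⟨s, hs⟩ := WithTop.ne_top_iff_exists.1 hω
        obtain ⟨q, hq, ⟨h1, h2⟩, hqs⟩ := (hσle ω s).1 hs.symm.le
        have h3 : s ≤ q := WithTop.coe_le_coe.1
          (hs.le.trans ((hσle ω q).2 ⟨q, hq, ⟨h1, h2⟩, le_rfl⟩))
        rw [payoff, if_neg hω, ← hs, withTop_untopA_coe, le_antisymm h3 hqs]
        exact h2.le
    _ ≤ _ := H.setLIntegral_payoff_le hμ hG hσ hσt x

theorem mul_measure_exists_lt_discounted_le {β : ℝ} {μ : Measure ℝ≥0} [SFinite μ]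
    (hμ : μ.map ((↑) : ℝ≥0 → ℝ) = expMeasure β) {g : S → ℝ≥0∞} {G : S → ℝ} (hGm : Measurable G)
    (hG : ∀ y, ENNReal.ofReal (G y) ≤ H.maxReward g μ y) (t : ℝ≥0) (ε : ℝ≥0∞) (x : S) :
    ε * H.P x {ω | ∃ q : ℚ≥0, t ≤ q ∧ ε < H.discounted β G q ω} ≤
      H.maxReward g (μ.restrict (Ioi t)) x := by
  have h : {ω | ∃ q : ℚ≥0, t ≤ q ∧ ε < H.discounted β G q ω} =
      ⋃ F : Finset ℚ≥0, {ω | ∃ q ∈ F, t ≤ q ∧ ε < H.discounted β G q ω} := by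
    ext ω
    simp only [mem_iUnion]
    exact ⟨fun ⟨q, hq⟩ => ⟨{q}, q, Finset.mem_singleton_self q, hq⟩, fun ⟨_, q, _, hq⟩ => ⟨q, hq⟩⟩
  have hdir : Monotone fun F : Finset ℚ≥0 =>
      {ω | ∃ q ∈ F, t ≤ q ∧ ε < H.discounted β G q ω} :=
    fun _ _ hF _ ⟨q, hq, h⟩ => ⟨q, hF hq, h⟩
  rw [h, hdir.directed_le.measure_iUnion, ENNReal.mul_iSup]
  exact iSup_le fun F => H.mul_measure_exists_finset_lt_discounted_le hμ hGm hG F t ε x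

/-- If the discounted reward of a lower semicontinuous `G` stays below a level at all rational times
from some time on, so it does at all times. -/
theorem discounted_le_of_forall_nnrat {β : ℝ} {G : S → ℝ} (hG : LowerSemicontinuous G) {ω : Ω}
    {e : ℝ} {r : ℝ≥0} (h : ∀ q : ℚ≥0, r ≤ q → H.discounted β G q ω ≤ ENNReal.ofReal e)
    (he : 0 ≤ e) {t : ℝ≥0} (ht : r ≤ t) : H.discounted β G t ω ≤ ENNReal.ofReal e := by
  by_contra! hlt
  have key : ∀ s : ℝ≥0, ENNReal.ofReal e < H.discounted β G s ω ↔
      e * Real.exp (β * s) < G (H.X s ω) := by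
    intro s
    rw [discounted, ENNReal.ofReal_lt_ofReal_iff_of_nonneg he, neg_mul, Real.exp_neg,
      inv_mul_eq_div, lt_div_iff₀ (Real.exp_pos _)]
  obtain ⟨c, hc1, hc2⟩ := exists_between ((key t).1 hlt)
  have h1 : ∀ᶠ s in 𝓝[>] t, c < G (H.X s ω) := (H.right_cts ω t).eventually (hG _ c hc2)
  have hcont : Continuous fun s : ℝ≥0 => e * Real.exp (β * s) := by fun_prop
  have h2 : ∀ᶠ s : ℝ≥0 in 𝓝[>] t, e * Real.exp (β * s) < c :=
    ((hcont.tendsto t).mono_left nhdsWithin_le_nhds).eventually (gt_mem_nhds hc1)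
  obtain ⟨u, hu, hu'⟩ := (mem_nhdsGT_iff_exists_Ioo_subset).1 (h1.and h2)
  obtain ⟨q, hq, hq'⟩ := exists_nnrat_btwn hu
  have h3 := hu' ⟨hq, hq'⟩
  exact absurd (h q (ht.trans hq.le)) (not_le.2 ((key q).2 (h3.2.trans h3.1)))

/-- The reward for never stopping is almost surely zero: by the maximal inequality, the probability
that the discounted reward exceeds `ε` after time `n` is at most `1 / ε` times the part of the
finite functional `maxReward` that belongs to exponential times after `n`. -/
theorem ae_limsup_discounted_eq_zero {β : ℝ} {μ : Measure ℝ≥0} [IsFiniteMeasure μ]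
    (hμ : μ.map ((↑) : ℝ≥0 → ℝ) = expMeasure β) {g : S → ℝ≥0∞} {G : S → ℝ}
    (hGlsc : LowerSemicontinuous G)
    (hG : ∀ y, ENNReal.ofReal (G y) ≤ H.maxReward g μ y) {x : S} (hx : H.maxReward g μ x ≠ ∞) :
    ∀ᵐ ω ∂H.P x, limsup (fun t : ℝ≥0 => H.discounted β G t ω) atTop = 0 := by
  have hnull : ∀ e : ℝ, 0 < e → ∀ᵐ ω ∂H.P x, ∃ n : ℕ, ∀ q : ℚ≥0, (n : ℝ≥0) ≤ q →
      H.discounted β G q ω ≤ ENNReal.ofReal e := by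
    intro e he
    rw [ae_iff]
    push Not
    have hle : ∀ n : ℕ, ENNReal.ofReal e * H.P x {ω | ∀ n : ℕ, ∃ q : ℚ≥0, (n : ℝ≥0) ≤ q ∧
        ENNReal.ofReal e < H.discounted β G q ω} ≤
        H.maxReward g (μ.restrict (Ioi (n : ℝ≥0))) x := fun n =>
      (mul_le_mul_right (measure_mono fun ω (hω : ∀ n : ℕ, ∃ q : ℚ≥0, (n : ℝ≥0) ≤ q ∧
        ENNReal.ofReal e < H.discounted β G q ω) => hω n) _).trans
        (H.mul_measure_exists_lt_discounted_le hμ hGlsc.measurable hG n (ENNReal.ofReal e) x)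
    have h0 := nonpos_iff_eq_zero.1 (ge_of_tendsto' (H.tendsto_maxReward_restrict_Ioi hx) hle)
    exact (mul_eq_zero.1 h0).resolve_left (ENNReal.ofReal_pos.2 he).ne'
  have hall : ∀ᵐ ω ∂H.P x, ∀ k : ℕ, ∃ n : ℕ, ∀ q : ℚ≥0, (n : ℝ≥0) ≤ q →
      H.discounted β G q ω ≤ ENNReal.ofReal (1 / ((k : ℝ) + 1)) :=
    ae_all_iff.2 fun k => hnull _ (by positivity)
  filter_upwards [hall] with ω hω
  have hlim : Tendsto (fun k : ℕ => ENNReal.ofReal (1 / ((k : ℝ) + 1))) atTop (𝓝 0) := by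
    simpa using ENNReal.tendsto_ofReal (tendsto_one_div_add_atTop_nhds_zero_nat (𝕜 := ℝ))
  refine nonpos_iff_eq_zero.1 (ge_of_tendsto' hlim fun k => ?_)
  obtain ⟨n, hn⟩ := hω k
  refine limsup_le_of_le (by isBoundedDefault) ?_
  filter_upwards [eventually_ge_atTop (n : ℝ≥0)] with t ht
  exact H.discounted_le_of_forall_nnrat hGlsc hn (by positivity) ht

theorem lintegral_payoff_le_maxReward {β : ℝ} {μ : Measure ℝ≥0} [IsFiniteMeasure μ]
    (hμ : μ.map ((↑) : ℝ≥0 → ℝ) = expMeasure β) {g : S → ℝ≥0∞} {G : S → ℝ}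
    (hGlsc : LowerSemicontinuous G)
    (hG : ∀ y, ENNReal.ofReal (G y) ≤ H.maxReward g μ y) {τ : Ω → WithTop ℝ≥0}
    (hτ : IsStoppingTime H.𝓕 τ) (x : S) :
    ∫⁻ ω, H.payoff β G τ ω ∂H.P x ≤ H.maxReward g μ x := by
  by_cases hx : H.maxReward g μ x = ∞
  · rw [hx]; exact le_top
  have hmeas := H.measurableSet_ne_top hτ
  have h0 : ∫⁻ ω in {ω | τ ω ≠ ⊤}ᶜ, H.payoff β G τ ω ∂H.P x = 0 := by
    rw [← lintegral_zero (μ := (H.P x).restrict {ω | τ ω ≠ ⊤}ᶜ)]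
    refine lintegral_congr_ae ?_
    filter_upwards [ae_restrict_of_ae (H.ae_limsup_discounted_eq_zero hμ hGlsc hG hx),
      ae_restrict_mem hmeas.compl] with ω h1 h2
    rw [payoff, if_pos (not_not.1 h2), h1]
  rw [← lintegral_add_compl _ hmeas, h0, add_zero]
  refine (H.setLIntegral_payoff_le hμ hG hτ (t := 0) (fun ω => bot_le) x).trans ?_
  exact H.maxReward_mono_measure g Measure.restrict_le_self x

/-! ### First passage attains the upper bound -/

/-- Until the first passage above `y` the running maximum does not exceed `y`. -/
theorem runningMax_le_of_lt_passageAbove {y : S} {ω : Ω} {u : ℝ≥0}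
    (h : (u : WithTop ℝ≥0) < H.passageAbove y ω) : H.runningMax u ω ≤ y := by
  refine csSup_le (s := (fun s => (H.X s ω : ℝ)) '' Iic u) ⟨_, 0, mem_Iic.2 zero_le, rfl⟩ ?_
  rintro _ ⟨s, hs, rfl⟩
  exact not_lt.1 (notMem_of_lt_hittingAfter ((WithTop.coe_le_coe.2 hs).trans_lt h) zero_le)

/-- After the first passage above `y` the running maximum is the maximum since that passage. -/
theorem runningMax_le_pathSup_passageAbove {y : S} {ω : Ω} (h : H.passageAbove y ω ≠ ⊤) {u : ℝ≥0}
    (hu : (H.passageAbove y ω).untopA < u) :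
    ((H.runningMax u ω : ℝ) : EReal) ≤ pathSup (H.pathFrom (H.passageAbove y ω).untopA ω)
      (u - (H.passageAbove y ω).untopA) := by
  obtain ⟨a, ha⟩ := WithTop.ne_top_iff_exists.1 h
  have hfreq := H.frequently_mem_of_hittingAfter_ne_top (U := Ioi y) h
  change ∃ᶠ s in 𝓝[≥] (H.passageAbove y ω).untopA, H.X s ω ∈ Ioi y at hfreq
  rw [← ha, withTop_untopA_coe] at hu hfreq ⊢
  obtain ⟨s', hs', hmem⟩ := (hfreq.and_eventually (Ico_mem_nhdsGE hu)).exists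
  have hle : ∀ s, a ≤ s → s ≤ u → ((H.X s ω : ℝ) : EReal) ≤ pathSup (H.pathFrom a ω) (u - a) := by
    intro s has hsu
    rw [H.pathSup_pathFrom]
    have := le_iSup₂ (f := fun (r : ℝ≥0) (_ : r ≤ u - a) => ((H.X (a + r) ω : ℝ) : EReal)) (s - a)
      (tsub_le_tsub_right hsu a)
    rwa [add_tsub_cancel_of_le has] at this
  rw [← H.pathSup_pathFrom_zero, H.pathSup_pathFrom 0]
  refine iSup₂_le fun s hs => ?_
  rw [zero_add]
  rcases le_or_gt a s with has | has
  · exact hle s has hs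
  · have h1 : H.X s ω ≤ y := by
      refine not_lt.1 (notMem_of_lt_hittingAfter (u := H.X) (s := Ioi y) (n := 0) ?_ zero_le)
      change (s : WithTop ℝ≥0) < H.passageAbove y ω
      rw [← ha]
      exact WithTop.coe_lt_coe.2 has
    have h2 : H.X s ω ≤ H.X s' ω := h1.trans hs'.le
    exact le_trans (by exact_mod_cast h2) (hle s' hmem.1 hmem.2.le)

theorem measure_singleton_of_map_coe_eq {β : ℝ} {μ : Measure ℝ≥0}
    (hμ : μ.map ((↑) : ℝ≥0 → ℝ) = expMeasure β) (t : ℝ≥0) : μ {t} = 0 := by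
  have h1 : expMeasure β {(t : ℝ)} = 0 :=
    withDensity_absolutelyContinuous volume (exponentialPDF β) (measure_singleton _)
  rw [← hμ, Measure.map_apply measurable_coe_nnreal_real (measurableSet_singleton _)] at h1
  exact measure_mono_null (fun s hs => by simpa using hs) h1

/-- First passage above `y` collects the whole maximum functional of a function that vanishes up to
`y`, if the reward equals that functional wherever the process can be at that time. -/
theorem maxReward_le_lintegral_payoff_passageAbove {β : ℝ} {μ : Measure ℝ≥0} [SFinite μ]
    (hμ : μ.map ((↑) : ℝ≥0 → ℝ) = expMeasure β) {g : S → ℝ≥0∞} (hg : Monotone g) {y : S}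
    (hgy : ∀ z ≤ y, g z = 0) {G : S → ℝ}
    (hG : ∀ z ∈ closure (Ioi y), ENNReal.ofReal (G z) = H.maxReward g μ z) (x : S) :
    H.maxReward g μ x ≤ ∫⁻ ω, H.payoff β G (H.passageAbove y) ω ∂H.P x := by
  have hτ : IsStoppingTime H.𝓕 (H.passageAbove y) :=
    H.isStoppingTime_hittingAfter_of_isOpen isOpen_Ioi
  have hmeas := H.measurableSet_ne_top hτ
  rw [H.maxReward_eq hg]
  calc ∫⁻ ω, ∫⁻ u, g (H.runningMax u ω) ∂μ ∂H.P x
      ≤ ∫⁻ ω, {ω | H.passageAbove y ω ≠ ⊤}.indicator (fun ω =>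
          ∫⁻ u in Ioi (H.passageAbove y ω).untopA,
            leftSup g (pathSup (H.pathFrom (H.passageAbove y ω).untopA ω)
              (u - (H.passageAbove y ω).untopA)) ∂μ) ω ∂H.P x := by
        refine lintegral_mono fun ω => ?_
        by_cases h : H.passageAbove y ω = ⊤
        · have h0 : ∀ u, g (H.runningMax u ω) = 0 := fun u =>
            hgy _ (H.runningMax_le_of_lt_passageAbove (h ▸ WithTop.coe_lt_top u))
          simp [h0]
        · rw [indicator_of_mem (show ω ∈ {ω | H.passageAbove y ω ≠ ⊤} from h),
            ← lintegral_indicator measurableSet_Ioi]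
          refine lintegral_mono_ae ?_
          -- The exponential time almost surely differs from the passage time.
          filter_upwards [measure_eq_zero_iff_ae_notMem.1
            (measure_singleton_of_map_coe_eq hμ (H.passageAbove y ω).untopA)] with u hu
          rcases lt_or_gt_of_ne (show u ≠ _ from hu) with hu | hu
          · rw [hgy _ (H.runningMax_le_of_lt_passageAbove ?_)]
            · exact zero_le
            · obtain ⟨a, ha⟩ := WithTop.ne_top_iff_exists.1 h
              rw [← ha, withTop_untopA_coe] at hu
              rw [← ha]
              exact WithTop.coe_lt_coe.2 hu
          · rw [indicator_of_mem (show u ∈ Ioi _ from hu), ← leftSup_coe hg]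
            exact monotone_leftSup g (H.runningMax_le_pathSup_passageAbove h hu)
    _ = _ := lintegral_indicator hmeas _
    _ = _ := (H.setLIntegral_exp_mul_maxReward hμ g hτ x).symm
    _ = ∫⁻ ω in {ω | H.passageAbove y ω ≠ ⊤}, H.payoff β G (H.passageAbove y) ω ∂H.P x := by
        refine setLIntegral_congr_fun hmeas fun ω hω => ?_
        rw [H.payoff_of_ne_top hω, ← hG (stoppedValue H.X (H.passageAbove y) ω)
          (H.stoppedValue_hittingAfter_mem_closure hω)]
    _ ≤ _ := setLIntegral_le_lintegral _ _

theorem value_eq_maxReward_and_isOptimal {β : ℝ} {μ : Measure ℝ≥0} [IsFiniteMeasure μ]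
    (hμ : μ.map ((↑) : ℝ≥0 → ℝ) = expMeasure β) {g : S → ℝ≥0∞} (hg : Monotone g) {y : S}
    (hgy : ∀ z ≤ y, g z = 0) {G : S → ℝ} (hGlsc : LowerSemicontinuous G)
    (hGle : ∀ z, ENNReal.ofReal (G z) ≤ H.maxReward g μ z)
    (hG : ∀ z ∈ closure (Ioi y), ENNReal.ofReal (G z) = H.maxReward g μ z) :
    (∀ x, H.value β G x = H.maxReward g μ x) ∧ H.IsOptimal β G (H.passageAbove y) := by
  have hτ : IsStoppingTime H.𝓕 (H.passageAbove y) :=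
    H.isStoppingTime_hittingAfter_of_isOpen isOpen_Ioi
  have hle : ∀ x, H.value β G x ≤ H.maxReward g μ x := fun x =>
    iSup₂_le fun τ hτ => H.lintegral_payoff_le_maxReward hμ hGlsc hGle hτ x
  have hge : ∀ x, H.maxReward g μ x ≤ ∫⁻ ω, H.payoff β G (H.passageAbove y) ω ∂H.P x :=
    H.maxReward_le_lintegral_payoff_passageAbove hμ hg hgy hG
  have hval : ∀ x, ∫⁻ ω, H.payoff β G (H.passageAbove y) ω ∂H.P x ≤ H.value β G x := fun x =>
    le_iSup₂ (f := fun (τ : Ω → WithTop ℝ≥0) (_ : IsStoppingTime H.𝓕 τ) =>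
      ∫⁻ ω, H.payoff β G τ ω ∂H.P x) _ hτ
  exact ⟨fun x => le_antisymm (hle x) ((hge x).trans (hval x)), hτ,
    fun x => le_antisymm (hval x) ((hle x).trans (hge x))⟩

/-- The two expectations of a nonnegative, monotone function, along the path and at the running
maximum, up to an independent time. -/
theorem expect_eq_maxReward {T : Ω → ℝ≥0} (hT : Measurable T) {x : S}
    (hTindep : IndepFun (fun ω t => H.X t ω) T (H.P x)) {f : S → ℝ} (hf : ∀ y, 0 ≤ f y)
    (hmono : Monotone fun y => ENNReal.ofReal (f y)) :
    H.expect x (fun ω => H.supUpTo f (T ω) ω) =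
        (H.maxReward (fun y => ENNReal.ofReal (f y)) ((H.P x).map T) x : EReal) ∧
      H.expect x (fun ω => ((f (H.runningMax (T ω) ω) : ℝ) : EReal)) =
        (H.maxReward (fun y => ENNReal.ofReal (f y)) ((H.P x).map T) x : EReal) := by
  rw [← H.lintegral_runningMax_indep hT hTindep hmono]
  constructor
  · rw [H.expect_eq_of_ae_nonneg]
    · congr 1
      refine lintegral_congr_ae ?_
      filter_upwards [H.ae_iSup_eq_runningMax hmono x] with ω hω
      rw [H.toENNReal_supUpTo, hω]
    · refine Eventually.of_forall fun ω => ?_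
      exact le_trans (by exact_mod_cast hf (H.X 0 ω))
        (le_iSup₂ (f := fun (s : ℝ≥0) (_ : s ≤ T ω) => (f (H.X s ω) : EReal)) 0 zero_le)
  · rw [H.expect_eq_of_ae_nonneg (Eventually.of_forall fun ω => by exact_mod_cast hf _)]
    congr 1

end HuntProcess

/-! ### The one-sided optimal stopping problem -/

theorem mainTheorem1 {S : Set ℝ} {Ω : Type*} [MeasurableSpace Ω] (H : HuntProcess S Ω)
    (β : ℝ) (hβ : 0 < β)
    -- an independent exponential time with mean `1 / β`
    (T : Ω → ℝ≥0) (hT : Measurable T)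
    (hTlaw : ∀ x, HasLaw (fun ω => (T ω : ℝ)) (expMeasure β) (H.P x))
    (hTindep : ∀ x, IndepFun (fun ω t => H.X t ω) T (H.P x))
    -- the reward function
    (G : S → ℝ) (hG0 : ∀ x, 0 ≤ G x) (hGlsc : LowerSemicontinuous G)
    (hGsup : ∀ x, ∫⁻ ω, ⨆ t, H.discounted β G t ω ∂H.P x < ∞)
    -- the representing function
    (f : S → ℝ) (hf : UpperSemicontinuous f) (xs : S)
    (hf_nonpos : ∀ x ≤ xs, f x ≤ 0)
    (hf_pos : ∀ x, xs < x → 0 < f x)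
    (hf_mono : MonotoneOn f (Ioi xs))
    (hfG_eq : ∀ x, xs ≤ x → H.expect x (fun ω => H.supUpTo f (T ω) ω) = (G x : EReal))
    (hfG_ge : ∀ x, x ≤ xs → (G x : EReal) ≤ H.expect x (fun ω => H.supUpTo f (T ω) ω)) :
    -- the value function
    (∀ x, (H.value β G x : EReal) =
        H.expect x (fun ω => H.supUpTo ((Ioi xs).indicator f) (T ω) ω) ∧
      (H.value β G x : EReal) =
        H.expect x (fun ω => (((Ioi xs).indicator f (H.runningMax (T ω) ω) : ℝ) : EReal))) ∧
    -- the same with weak inequalities in the indicators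
    (0 ≤ f xs → ∀ x, (H.value β G x : EReal) =
        H.expect x (fun ω => H.supUpTo ((Ici xs).indicator f) (T ω) ω) ∧
      (H.value β G x : EReal) =
        H.expect x (fun ω => (((Ici xs).indicator f (H.runningMax (T ω) ω) : ℝ) : EReal))) ∧
    -- the optimal stopping time
    H.IsOptimal β G (H.passageAbove xs) := by
  set g : S → ℝ≥0∞ := fun y => ENNReal.ofReal (f y) with hgdef
  have hgy : ∀ z ≤ xs, g z = 0 := fun z hz => ENNReal.ofReal_of_nonpos (hf_nonpos z hz)
  have hg : Monotone g := by
    intro a b hab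
    rcases le_or_gt a xs with ha | ha
    · rw [hgy a ha]; exact zero_le
    · exact ENNReal.ofReal_le_ofReal (hf_mono ha (ha.trans_le hab) hab)
  have hind0 : ∀ y, 0 ≤ (Ioi xs).indicator f y :=
    indicator_nonneg fun y hy => (hf_pos y hy).le
  have hindg : (fun y => ENNReal.ofReal ((Ioi xs).indicator f y)) = g := by
    funext y
    by_cases hy : y ∈ Ioi xs
    · rw [indicator_of_mem hy]
    · rw [indicator_of_notMem hy, hgy y (not_lt.1 hy), ENNReal.ofReal_zero]
  -- The law of the exponential time does not depend on the starting point.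
  set μ : Measure ℝ≥0 := (H.P xs).map T with hμdef
  have hμ' : ∀ x, ((H.P x).map T).map ((↑) : ℝ≥0 → ℝ) = expMeasure β := fun x => by
    rw [Measure.map_map measurable_coe_nnreal_real hT]
    exact (hTlaw x).map_eq
  have hμ : μ.map ((↑) : ℝ≥0 → ℝ) = expMeasure β := hμ' xs
  have hμx : ∀ x, (H.P x).map T = μ := by
    intro x
    have h : ∀ ν : Measure ℝ≥0, (ν.map ((↑) : ℝ≥0 → ℝ)).map Real.toNNReal = ν := by
      intro ν
      rw [Measure.map_map measurable_real_toNNReal measurable_coe_nnreal_real]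
      have : Real.toNNReal ∘ ((↑) : ℝ≥0 → ℝ) = id := by funext r; simp
      rw [this, Measure.map_id]
    rw [← h ((H.P x).map T), hμ', ← hμ, h]
  have : IsProbabilityMeasure μ := Measure.isProbabilityMeasure_map hT.aemeasurable
  have hpos : ∀ x, ∫⁻ ω, (H.supUpTo f (T ω) ω).toENNReal ∂H.P x = H.maxReward g μ x := by
    intro x
    rw [← hμx x, ← H.lintegral_runningMax_indep hT (hTindep x) hg]
    refine lintegral_congr_ae ?_
    filter_upwards [H.ae_iSup_eq_runningMax hg x] with ω hω
    rw [H.toENNReal_supUpTo, ← hω]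
  have hGcoe : ∀ y, (G y : EReal) = (ENNReal.ofReal (G y) : EReal) := fun y => by
    rw [EReal.coe_ennreal_ofReal, max_eq_left (hG0 y)]
  have hGle : ∀ y, ENNReal.ofReal (G y) ≤ H.maxReward g μ y := by
    intro y
    rw [← EReal.coe_ennreal_le_coe_ennreal_iff, ← hGcoe, ← hpos]
    rcases le_total xs y with hy | hy
    · rw [← hfG_eq y hy]
      exact H.expect_le y _
    · exact (hfG_ge y hy).trans (H.expect_le y _)
  have hGeq : ∀ y ∈ closure (Ioi xs), ENNReal.ofReal (G y) = H.maxReward g μ y := by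
    intro y hy
    have hxy : xs ≤ y := closure_minimal (fun z hz => le_of_lt hz) isClosed_Ici hy
    -- Upper semicontinuity carries positivity on `{y > xs}` over to the closure.
    have hfy : 0 ≤ f y := by
      by_contra! hneg
      obtain ⟨z, hz, hz'⟩ := mem_closure_iff_nhds.1 hy _ (hf y 0 hneg)
      exact absurd (hf_pos z hz') (not_lt.2 (le_of_lt hz))
    rw [← EReal.coe_ennreal_eq_coe_ennreal_iff, ← hGcoe, ← hfG_eq y hxy, ← hpos]
    refine H.expect_eq_of_ae_nonneg ?_
    filter_upwards [H.start y] with ω hω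
    have h1 : (f (H.X 0 ω) : EReal) ≤ H.supUpTo f (T ω) ω :=
      le_iSup₂ (f := fun (s : ℝ≥0) (_ : s ≤ T ω) => (f (H.X s ω) : EReal)) 0 zero_le
    rw [hω] at h1
    exact le_trans (by exact_mod_cast hfy) h1
  obtain ⟨hval, hopt⟩ := H.value_eq_maxReward_and_isOptimal hμ hg hgy hGlsc hGle hGeq
  have hfirst : ∀ x, (H.value β G x : EReal) =
        H.expect x (fun ω => H.supUpTo ((Ioi xs).indicator f) (T ω) ω) ∧
      (H.value β G x : EReal) =
        H.expect x (fun ω => (((Ioi xs).indicator f (H.runningMax (T ω) ω) : ℝ) : EReal)) := by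
    intro x
    have h := H.expect_eq_maxReward hT (hTindep x) hind0 (by rw [hindg]; exact hg)
    rw [hindg, hμx x, ← hval x] at h
    exact ⟨h.1.symm, h.2.symm⟩
  refine ⟨hfirst, fun h0 => ?_, hopt⟩
  have hIci : (Ici xs).indicator f = (Ioi xs).indicator f := by
    funext y
    rcases lt_trichotomy xs y with hy | rfl | hy
    · rw [indicator_of_mem (show y ∈ Ici xs from hy.le), indicator_of_mem (show y ∈ Ioi xs from hy)]
    · rw [indicator_of_mem self_mem_Ici, indicator_of_notMem self_notMem_Ioi]
      exact le_antisymm (hf_nonpos _ le_rfl) h0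
    · rw [indicator_of_notMem (show y ∉ Ici xs from not_le.2 hy),
        indicator_of_notMem (show y ∉ Ioi xs from not_lt.2 hy.le)]
  rw [hIci]
  exact hfirst
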